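/- For symmetric $A_0,A_1\in\mathbb{R}^{n\times n}$, $b_0,b_1\in\mathbb{R}^n$ and $c_0,c_1\in\mathbb{R}$ let $q_i(x)=x^\top A_ix+2b_i^\top x+c_i$ for $i=0,1$, let $A(\gamma)=A_0+\gamma A_1$, and let $\mathrm{Opt}=\inf\{q_0(x):x\in\mathbb{R}^n,\ q_1(x)\le 0\}$. Assume that (i) $A_0$ and $A_1$ each have a negative eigenvalue, and there is a $\gamma^*\ge 0$ such that $A(\gamma^*)$ is positive definite; (ii) $\|A_0\|,\|A_1\|,\|b_0\|,\|b_1\|,|c_1|\le 1$ (spectral norms for the matrices, Euclidean norms for the vectors). Let $\gamma_+=\max\{\gamma\ge 0: A(\gamma)\succeq 0\}$, $\zeta^*=\max\{1,\gamma_+\}$, $\xi^*=\min\{1,\max_{\gamma\ge0}\lambda_{\min}(A(\gamma))\}$ and $\kappa^*=\zeta^*/\xi^*$. There exist a deterministic algorithm (one fixed program, for all $n$, of a real random access machine that performs $+,-,\times,/,\sqrt{\cdot}$ and comparisons of real numbers, addition and subtraction of natural numbers, and indexed memory accesses, each in unit time, with only rational constants) and an absolute constant $C$ with the following property. For every $n$,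 every $q_0,q_1$ on $\mathbb{R}^n$ that satisfy (i) and (ii) and have diagonal $A_0$ and $A_1$, and every $\epsilon>0$, the algorithm, given $n$, the diagonals of $A_0,A_1$, the vectors $b_0,b_1$ and the numbers $c_0,c_1,\epsilon$, halts and outputs $\bar x\in\mathbb{R}^n$ such that $$q_0(\bar x)\le \mathrm{Opt}+\epsilon,\qquad q_1(\bar x)=0,$$ and its running time is at most $$C\,n\,\max\Bigl\{1,\frac{\kappa^*\sqrt{\zeta^*}}{\sqrt{\epsilon}}\Bigr\}.$$ In particular, it is $O\bigl(n\kappa^*\sqrt{\zeta^*}/\sqrt{\epsilon}\bigr)$ whenever $\epsilon\le(\kappa^*)^2\zeta^*$. -/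

import Mathlib

/-! ### Quadratic functions and the generalized trust-region subproblem -/

/-- The data of a quadratic function `q(x) = xᵀ A x + 2 bᵀ x + c` on `ℝⁿ`, with `A` symmetric. -/
structure QuadFun (n : ℕ) where
  A : Matrix (Fin n) (Fin n) ℝ
  symm : A.IsSymm
  b : EuclideanSpace ℝ (Fin n)
  c : ℝ

/-- The value `xᵀ A x + 2 bᵀ x + c`. -/
noncomputable def QuadFun.eval {n : ℕ} (q : QuadFun n) (x : EuclideanSpace ℝ (Fin n)) : ℝ :=
  inner ℝ x (Matrix.toEuclideanLin q.A x) + 2 * inner ℝ q.b x + q.c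

/-- The spectral norm of a matrix: its operator norm for the Euclidean norm. -/
noncomputable def spectralNorm₂ {n : ℕ} (A : Matrix (Fin n) (Fin n) ℝ) : ℝ :=
  ‖Matrix.toEuclideanCLM (n := Fin n) (𝕜 := ℝ) A‖

/-- The least eigenvalue of a (symmetric) matrix. -/
noncomputable def lambdaMin {n : ℕ} (A : Matrix (Fin n) (Fin n) ℝ) : ℝ :=
  sInf (spectrum ℝ A)

namespace GTRS

/-- The matrix pencil `A(γ) = A₀ + γ A₁`. -/
def pencil {n : ℕ} (q₀ q₁ : QuadFun n) (γ : ℝ) : Matrix (Fin n) (Fin n) ℝ :=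
  q₀.A + γ • q₁.A

/-- The optimal value `inf { q₀(x) : q₁(x) ≤ 0 }`. -/
noncomputable def opt {n : ℕ} (q₀ q₁ : QuadFun n) : ℝ :=
  sInf (q₀.eval '' {x | q₁.eval x ≤ 0})

/-- The standing assumption: both quadratics are nonconvex, some nonnegative aggregation of
them is strongly convex, and the data are normalized. -/
structure Assumption {n : ℕ} (q₀ q₁ : QuadFun n) : Prop where
  neg_eig₀ : ∃ μ ∈ spectrum ℝ q₀.A, μ < 0
  neg_eig₁ : ∃ μ ∈ spectrum ℝ q₁.A, μ < 0
  posDef : ∃ γ : ℝ, 0 ≤ γ ∧ (pencil q₀ q₁ γ).PosDef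
  norm_A₀ : spectralNorm₂ q₀.A ≤ 1
  norm_A₁ : spectralNorm₂ q₁.A ≤ 1
  norm_b₀ : ‖q₀.b‖ ≤ 1
  norm_b₁ : ‖q₁.b‖ ≤ 1
  abs_c₁ : |q₁.c| ≤ 1

/-- `γ₊`, the right end point of `Γ = {γ ≥ 0 : A(γ) ⪰ 0}`. Under `Assumption`, `Γ` is a nonempty
compact interval. -/
noncomputable def gammaPlus {n : ℕ} (q₀ q₁ : QuadFun n) : ℝ :=
  sSup {γ : ℝ | 0 ≤ γ ∧ (pencil q₀ q₁ γ).PosSemidef}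

/-- `ζ* = max {1, γ₊}`. -/
noncomputable def zetaStar {n : ℕ} (q₀ q₁ : QuadFun n) : ℝ :=
  max 1 (gammaPlus q₀ q₁)

/-- `ξ* = min {1, max_{γ ≥ 0} λ_min(A(γ))}`. Under `Assumption` the maximum is attained. -/
noncomputable def xiStar {n : ℕ} (q₀ q₁ : QuadFun n) : ℝ :=
  min 1 (sSup ((fun γ : ℝ => lambdaMin (pencil q₀ q₁ γ)) '' Set.Ici 0))

/-- `κ* = ζ* / ξ*`. -/
noncomputable def kappaStar {n : ℕ} (q₀ q₁ : QuadFun n) : ℝ :=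
  zetaStar q₀ q₁ / xiStar q₀ q₁

end GTRS

/-! ### Deterministic programs of a real random access machine

A state has natural-number registers and arrays (used for counters and addresses) and
real-number registers and arrays. Programs are finite, do not depend on the instance, and are
built from assignments, sequencing, branching and loops. Each read of a constant, register or
array cell, each arithmetic operation `+, -, *, /, √` on reals, each `+, -` on naturals, each
comparison, and each write costs one unit of time. -/

namespace RealRAM

structure State where
  nreg : ℕ → ℕ
  narr : ℕ → ℕ → ℕ
  rreg : ℕ → ℝ
  rarr : ℕ → ℕ → ℝ

/-- Natural-number expressions; `get a e` reads cell `e` of the array `a`. Subtraction is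
truncated. -/
inductive NExp where
  | const (k : ℕ)
  | reg (v : ℕ)
  | get (a : ℕ) (e : NExp)
  | add (e f : NExp)
  | sub (e f : NExp)

/-- Real expressions; only rational constants may occur in a program. -/
inductive RExp where
  | const (k : ℚ)
  | reg (v : ℕ)
  | get (a : ℕ) (e : NExp)
  | add (e f : RExp)
  | sub (e f : RExp)
  | mul (e f : RExp)
  | div (e f : RExp)
  | sqrt (e : RExp)

/-- Tests. -/
inductive BExp where
  | nle (e f : NExp)
  | rle (e f : RExp)
  | not (b : BExp)
  | and (b c : BExp)

/-- Programs. -/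
inductive Cmd where
  | skip
  | nset (v : ℕ) (e : NExp)
  | nput (a : ℕ) (i : NExp) (e : NExp)
  | rset (v : ℕ) (e : RExp)
  | rput (a : ℕ) (i : NExp) (e : RExp)
  | seq (P Q : Cmd)
  | ite (b : BExp) (P Q : Cmd)
  | loop (b : BExp) (P : Cmd)

def NExp.val (s : State) : NExp → ℕ
  | .const k => k
  | .reg v => s.nreg v
  | .get a e => s.narr a (e.val s)
  | .add e f => e.val s + f.val s
  | .sub e f => e.val s - f.val s

/-- Division by zero and the square root of a negative number return `0`. -/
noncomputable def RExp.val (s : State) : RExp → ℝ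
  | .const k => (k : ℝ)
  | .reg v => s.rreg v
  | .get a e => s.rarr a (e.val s)
  | .add e f => e.val s + f.val s
  | .sub e f => e.val s - f.val s
  | .mul e f => e.val s * f.val s
  | .div e f => e.val s / f.val s
  | .sqrt e => Real.sqrt (e.val s)

def BExp.holds (s : State) : BExp → Prop
  | .nle e f => e.val s ≤ f.val s
  | .rle e f => e.val s ≤ f.val s
  | .not b => ¬ b.holds s
  | .and b c => b.holds s ∧ c.holds s

def NExp.cost : NExp → ℕ
  | .const _ => 1
  | .reg _ => 1
  | .get _ e => e.cost + 1
  | .add e f => e.cost + f.cost + 1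
  | .sub e f => e.cost + f.cost + 1

def RExp.cost : RExp → ℕ
  | .const _ => 1
  | .reg _ => 1
  | .get _ e => e.cost + 1
  | .add e f => e.cost + f.cost + 1
  | .sub e f => e.cost + f.cost + 1
  | .mul e f => e.cost + f.cost + 1
  | .div e f => e.cost + f.cost + 1
  | .sqrt e => e.cost + 1

def BExp.cost : BExp → ℕ
  | .nle e f => e.cost + f.cost + 1
  | .rle e f => e.cost + f.cost + 1
  | .not b => b.cost + 1
  | .and b c => b.cost + c.cost + 1

def State.setN (s : State) (v k : ℕ) : State :=
  { s with nreg := Function.update s.nreg v k }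

def State.putN (s : State) (a i k : ℕ) : State :=
  { s with narr := Function.update s.narr a (Function.update (s.narr a) i k) }

noncomputable def State.setR (s : State) (v : ℕ) (r : ℝ) : State :=
  { s with rreg := Function.update s.rreg v r }

noncomputable def State.putR (s : State) (a i : ℕ) (r : ℝ) : State :=
  { s with rarr := Function.update s.rarr a (Function.update (s.rarr a) i r) }

/-- `Exec P s t s'`: the program `P`, started in state `s`, halts after `t` units of time in
state `s'`. -/
inductive Exec : Cmd → State → ℕ → State → Prop where
  | skip (s : State) : Exec .skip s 1 s
  | nset (s : State) (v : ℕ) (e : NExp) :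
      Exec (.nset v e) s (e.cost + 1) (s.setN v (e.val s))
  | nput (s : State) (a : ℕ) (i e : NExp) :
      Exec (.nput a i e) s (i.cost + e.cost + 1) (s.putN a (i.val s) (e.val s))
  | rset (s : State) (v : ℕ) (e : RExp) :
      Exec (.rset v e) s (e.cost + 1) (s.setR v (e.val s))
  | rput (s : State) (a : ℕ) (i : NExp) (e : RExp) :
      Exec (.rput a i e) s (i.cost + e.cost + 1) (s.putR a (i.val s) (e.val s))
  | seq {P Q : Cmd} {s s' s'' : State} {t u : ℕ} :
      Exec P s t s' → Exec Q s' u s'' → Exec (.seq P Q) s (t + u) s''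
  | ite_true {b : BExp} {P Q : Cmd} {s s' : State} {t : ℕ} :
      b.holds s → Exec P s t s' → Exec (.ite b P Q) s (b.cost + t + 1) s'
  | ite_false {b : BExp} {P Q : Cmd} {s s' : State} {t : ℕ} :
      ¬ b.holds s → Exec Q s t s' → Exec (.ite b P Q) s (b.cost + t + 1) s'
  | loop_done {b : BExp} {P : Cmd} {s : State} :
      ¬ b.holds s → Exec (.loop b P) s (b.cost + 1) s
  | loop_step {b : BExp} {P : Cmd} {s s' s'' : State} {t u : ℕ} :
      b.holds s → Exec P s t s' → Exec (.loop b P) s' u s'' →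
      Exec (.loop b P) s (b.cost + t + u + 1) s''

/-- Programs are deterministic: the running time and the final state are determined by the
program and the initial state. -/
theorem Exec.deterministic {P : Cmd} {s s₁ s₂ : State} {t₁ t₂ : ℕ}
    (h₁ : Exec P s t₁ s₁) (h₂ : Exec P s t₂ s₂) : t₁ = t₂ ∧ s₁ = s₂ := by
  induction h₁ generalizing t₂ s₂ with
  | skip | nset | nput | rset | rput => cases h₂; exact ⟨rfl, rfl⟩
  | seq _ _ ih₁ ih₂ =>
    cases h₂ with
    | seq k₁ k₂ =>
      obtain ⟨rfl, rfl⟩ := ih₁ k₁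
      obtain ⟨rfl, rfl⟩ := ih₂ k₂
      exact ⟨rfl, rfl⟩
  | ite_true hb _ ih =>
    cases h₂ with
    | ite_true _ k => obtain ⟨rfl, rfl⟩ := ih k; exact ⟨rfl, rfl⟩
    | ite_false hb' _ => exact absurd hb hb'
  | ite_false hb _ ih =>
    cases h₂ with
    | ite_true hb' _ => exact absurd hb' hb
    | ite_false _ k => obtain ⟨rfl, rfl⟩ := ih k; exact ⟨rfl, rfl⟩
  | loop_done hb =>
    cases h₂ with
    | loop_done _ => exact ⟨rfl, rfl⟩
    | loop_step hb' _ _ => exact absurd hb' hb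
  | loop_step hb _ _ ih₁ ih₂ =>
    cases h₂ with
    | loop_done hb' => exact absurd hb hb'
    | loop_step _ k₁ k₂ =>
      obtain ⟨rfl, rfl⟩ := ih₁ k₁
      obtain ⟨rfl, rfl⟩ := ih₂ k₂
      exact ⟨rfl, rfl⟩

/-- The list `v₀, …, v_{n-1}` as the contents of an array, followed by zeros. -/
noncomputable def ofVec {n : ℕ} (v : Fin n → ℝ) (i : ℕ) : ℝ :=
  if h : i < n then v ⟨i, h⟩ else 0

/-- The initial state for a pair of quadratic functions with diagonal matrices and an accuracy
`ε`: natural register `0` holds `n`, real registers `0, 1, 2` hold `c₀, c₁, ε`, and real arrays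
`0, 1, 2, 3` hold the diagonals of `A₀`, `A₁` and the vectors `b₀`, `b₁`. Everything else is
zero. -/
noncomputable def input {n : ℕ} (q₀ q₁ : QuadFun n) (ε : ℝ) : State where
  nreg v := if v = 0 then n else 0
  narr _ _ := 0
  rreg v := match v with
    | 0 => q₀.c
    | 1 => q₁.c
    | 2 => ε
    | _ => 0
  rarr a := match a with
    | 0 => ofVec q₀.A.diag
    | 1 => ofVec q₁.A.diag
    | 2 => ofVec q₀.b
    | 3 => ofVec q₁.b
    | _ => fun _ => 0

/-- The output vector: the first `n` cells of real array `4`. -/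
noncomputable def output (n : ℕ) (s : State) : EuclideanSpace ℝ (Fin n) :=
  WithLp.toLp 2 fun i : Fin n => s.rarr 4 i

end RealRAM

/-! For `γ` in the open interval `(α, β)` where `A(γ) ≻ 0`, let `x(γ)` minimize `q₀ + γ q₁`. The
slope `h(γ) = q₁(x(γ))` of the concave dual function is antitone. At `α` and `β` the pencil
degenerates along coordinate axes `j` and `k`, because the matrices are diagonal. Moving from `x(γ)`
along `k` (if `h(γ) ≥ 0`) or `j` (if `h(γ) < 0`) to the surface `q₁ = 0` costs at most `(β - γ)
h(γ)`, respectively `(γ - α)(-h(γ))`, in the aggregate `q₀ + γ q₁` (`DiagData.diag_mul_step_sq_le`).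
By weak duality the point reached is `ε`-optimal once these quantities are at most `ε`
(`DiagData.q₀_update_step_le`).

Such a `γ` is found by bisection on the sign of `h`, each evaluation costing `O(n)`. Let `H` bound
`|h|` on the middle half of `(α, β)`. That bound also controls the variation of `h` at distance `d`
from the end points, with Lipschitz constant `3H(β - α)²/d³` (`DiagData.IsInterval.slope_sub_le`). A
bracket whose ends fail the test therefore cannot be short, and `m` halvings force `2^m < 24 max(1,
H(β - α)/ε)³` (`Bracket.two_pow_lt`).

Normalization gives `H = 130 κ*²`, and `β = γ₊ ≤ ζ*`. So the number of halvings is logarithmic in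
`κ*² ζ*/ε`, which the claimed square-root bound dominates (`Bracket.lt_bound`). -/

namespace RealRAM

/-! ### Program logic with time bounds. -/

/-- `Runs P s T Q`: started in `s`, the program `P` halts within `T` units of time in a state
satisfying `Q`. -/
def Runs (P : Cmd) (s : State) (T : ℕ) (Q : State → Prop) : Prop :=
  ∃ (t : ℕ) (s' : State), Exec P s t s' ∧ t ≤ T ∧ Q s'

theorem Runs.mono {P : Cmd} {s : State} {T T' : ℕ} {Q Q' : State → Prop}
    (h : Runs P s T Q) (hT : T ≤ T') (hQ : ∀ s', Q s' → Q' s') : Runs P s T' Q' := by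
  obtain ⟨t, s', he, ht, hq⟩ := h
  exact ⟨t, s', he, ht.trans hT, hQ _ hq⟩

theorem Runs.nset {s : State} {v : ℕ} {e : NExp} {Q : State → Prop}
    (h : Q (s.setN v (e.val s))) : Runs (.nset v e) s (e.cost + 1) Q :=
  ⟨_, _, .nset s v e, le_rfl, h⟩

theorem Runs.rset {s : State} {v : ℕ} {e : RExp} {Q : State → Prop}
    (h : Q (s.setR v (e.val s))) : Runs (.rset v e) s (e.cost + 1) Q :=
  ⟨_, _, .rset s v e, le_rfl, h⟩

theorem Runs.rput {s : State} {a : ℕ} {i : NExp} {e : RExp} {Q : State → Prop}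
    (h : Q (s.putR a (i.val s) (e.val s))) : Runs (.rput a i e) s (i.cost + e.cost + 1) Q :=
  ⟨_, _, .rput s a i e, le_rfl, h⟩

theorem Runs.skip {s : State} {Q : State → Prop} (h : Q s) : Runs .skip s 1 Q :=
  ⟨_, _, .skip s, le_rfl, h⟩

/-- The run of `P₂` is the postcondition of `P₁`, so proofs follow the program without naming
intermediate states. -/
theorem Runs.seq {P₁ P₂ : Cmd} {s : State} {T₁ T₂ : ℕ} {Q : State → Prop}
    (h : Runs P₁ s T₁ fun s' => Runs P₂ s' T₂ Q) : Runs (.seq P₁ P₂) s (T₁ + T₂) Q := by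
  obtain ⟨t, s', he, ht, u, s'', he', hu, hq⟩ := h
  exact ⟨_, _, .seq he he', add_le_add ht hu, hq⟩

theorem Runs.ite {b : BExp} {P₁ P₂ : Cmd} {s : State} {T : ℕ} {Q : State → Prop}
    (h₁ : b.holds s → Runs P₁ s T Q) (h₂ : ¬ b.holds s → Runs P₂ s T Q) :
    Runs (.ite b P₁ P₂) s (b.cost + T + 1) Q := by
  by_cases hb : b.holds s
  · obtain ⟨t, s', he, ht, hq⟩ := h₁ hb
    exact ⟨_, _, .ite_true hb he, by omega, hq⟩
  · obtain ⟨t, s', he, ht, hq⟩ := h₂ hb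
    exact ⟨_, _, .ite_false hb he, by omega, hq⟩

/-- A loop whose `k`-th body run takes the invariant `I k` to `I (k + 1)` and whose guard fails
at the latest after `K` runs. -/
theorem Runs.loop {b : BExp} {P : Cmd} {T K : ℕ} (I : ℕ → State → Prop)
    (hK : ∀ k s, I k s → b.holds s → k < K)
    (step : ∀ k s, I k s → b.holds s → Runs P s T (I (k + 1))) {s : State} (h0 : I 0 s) :
    Runs (.loop b P) s (K * (b.cost + T + 1) + (b.cost + 1))
      fun s' => (∃ k ≤ K, I k s') ∧ ¬ b.holds s' := by
  have key : ∀ j k s, k + j = K → I k s →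
      Runs (.loop b P) s (j * (b.cost + T + 1) + (b.cost + 1))
        fun s' => (∃ k ≤ K, I k s') ∧ ¬ b.holds s' := by
    intro j
    induction j with
    | zero =>
      intro k s hk hI
      have hb : ¬ b.holds s := fun hb => by have := hK k s hI hb; omega
      exact ⟨_, _, .loop_done hb, by omega, ⟨k, by omega, hI⟩, hb⟩
    | succ j ih =>
      intro k s hk hI
      by_cases hb : b.holds s
      · obtain ⟨t, s', he, ht, hI'⟩ := step k s hI hb
        obtain ⟨u, s'', he', hu, hq⟩ := ih (k + 1) s' (by omega) hI'
        refine ⟨_, _, .loop_step hb he he', ?_, hq⟩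
        rw [Nat.succ_mul]
        omega
      · exact ⟨_, _, .loop_done hb, by omega, ⟨k, by omega, hI⟩, hb⟩
  exact key K 0 s (by omega) h0

/-- Run `P` with natural register `1` counting from `0` up to the value of natural
register `0`. -/
def forLoop (P : Cmd) : Cmd :=
  .seq (.nset 1 (.const 0))
    (.loop (.nle (.add (.reg 1) (.const 1)) (.reg 0))
      (.seq P (.nset 1 (.add (.reg 1) (.const 1)))))

/-- The invariant must survive any write to register `1`, since the loop itself changes the counter.
The overhead is 10 per pass (guard 5, increment 4, branch 1), and 8 for initialization and the final
failing guard. -/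
theorem Runs.forLoop {P : Cmd} {n T : ℕ} (I : ℕ → State → Prop)
    (hn : ∀ k s, I k s → s.nreg 0 = n) (hI : ∀ k l s, I k s → I k (s.setN 1 l))
    (step : ∀ k s, k < n → s.nreg 1 = k → I k s →
      Runs P s T fun s' => s'.nreg 1 = k ∧ I (k + 1) s')
    {s : State} (h0 : I 0 s) :
    Runs (forLoop P) s (n * (T + 10) + 8) (I n) := by
  have hloop := Runs.loop (b := .nle (.add (.reg 1) (.const 1)) (.reg 0))
    (P := .seq P (.nset 1 (.add (.reg 1) (.const 1)))) (K := n) (T := T + 4)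
    (fun k s => s.nreg 1 = k ∧ k ≤ n ∧ I k s)
    (by
      rintro k s ⟨h1, h2, h3⟩ hb
      simp only [BExp.holds, NExp.val, hn _ _ h3, h1] at hb
      omega)
    (by
      rintro k s ⟨h1, h2, h3⟩ hb
      simp only [BExp.holds, NExp.val, hn _ _ h3, h1] at hb
      refine Runs.seq ((step k s (by omega) h1 h3).mono le_rfl ?_)
      rintro s' ⟨hk, hs'⟩
      refine Runs.nset ⟨?_, by omega, hI _ _ _ hs'⟩
      simp [State.setN, NExp.val, hk])
    (s := s.setN 1 0) ⟨by simp [State.setN], by omega, hI _ _ _ h0⟩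
  have := Runs.seq (P₁ := .nset 1 (.const 0)) (s := s) (Runs.nset (e := .const 0) hloop)
  refine this.mono ?_ ?_
  · simp only [BExp.cost, NExp.cost]
    ring_nf
    omega
  · rintro s' ⟨⟨k, hk, h1, h2, h3⟩, hb⟩
    simp only [BExp.holds, NExp.val, hn _ _ h3, h1] at hb
    obtain rfl : k = n := by omega
    exact h3

/-- Raise real register `r` to the largest of the ratios `-B i / A i` with `0 < A i`, and record
its index in natural register `v`. -/
def maxRatio (A B v r : ℕ) : Cmd :=
  forLoop
    (.ite (.and (.not (.rle (.get A (.reg 1)) (.const 0)))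
        (.not (.rle (.div (.sub (.const 0) (.get B (.reg 1))) (.get A (.reg 1))) (.reg r))))
      (.seq (.rset r (.div (.sub (.const 0) (.get B (.reg 1))) (.get A (.reg 1))))
        (.nset v (.reg 1)))
      .skip)

/-- The register starts at `0`, so the recorded index is meaningful only if the final value is
positive. -/
theorem runs_maxRatio {A B v r n : ℕ} (hv0 : v ≠ 0) (hv1 : v ≠ 1) {s : State}
    (hn : s.nreg 0 = n) (hr : s.rreg r = 0) :
    Runs (maxRatio A B v r) s (n * 37 + 8) fun s' =>
      s'.rarr = s.rarr ∧ (∀ w, w ≠ 1 → w ≠ v → s'.nreg w = s.nreg w) ∧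
      (∀ w, w ≠ r → s'.rreg w = s.rreg w) ∧
      (∀ i < n, 0 < s.rarr A i → -s.rarr B i / s.rarr A i ≤ s'.rreg r) ∧ 0 ≤ s'.rreg r ∧
      (0 < s'.rreg r → s'.nreg v < n ∧ 0 < s.rarr A (s'.nreg v) ∧
        s'.rreg r = -s.rarr B (s'.nreg v) / s.rarr A (s'.nreg v)) := by
  refine Runs.mono (T := n * (27 + 10) + 8) (Runs.forLoop (n := n) (fun k s' =>
      s'.rarr = s.rarr ∧ (∀ w, w ≠ 1 → w ≠ v → s'.nreg w = s.nreg w) ∧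
      (∀ w, w ≠ r → s'.rreg w = s.rreg w) ∧
      (∀ i < k, 0 < s.rarr A i → -s.rarr B i / s.rarr A i ≤ s'.rreg r) ∧ 0 ≤ s'.rreg r ∧
      (0 < s'.rreg r → s'.nreg v < n ∧ 0 < s.rarr A (s'.nreg v) ∧
        s'.rreg r = -s.rarr B (s'.nreg v) / s.rarr A (s'.nreg v))) ?_ ?_ ?_ ?_) le_rfl
        (fun _ h => h)
  · rintro k s' ⟨_, h, _⟩
    rw [h 0 (by omega) (by omega), hn]
  · rintro k l s' ⟨h1, h2, h3, h4, h5, h6⟩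
    refine ⟨h1, fun w hw hw' => ?_, h3, h4, h5, ?_⟩
    · simpa [State.setN, Function.update_of_ne hw] using h2 w hw hw'
    · simpa [State.setN, Function.update_of_ne hv1] using h6
  · rintro k s' hk hc ⟨h1, h2, h3, h4, h5, h6⟩
    refine (Runs.ite (T := 10) ?_ ?_).mono (by simp [BExp.cost, RExp.cost, NExp.cost])
      (fun _ h => h)
    · intro hb
      simp only [BExp.holds, RExp.val, NExp.val, hc, h1, not_le, Rat.cast_zero, zero_sub] at hb
      refine (Runs.seq (Runs.rset (Runs.nset ?_))).mono
        (by simp [RExp.cost, NExp.cost]) (fun _ h => h)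
      simp only [RExp.val, NExp.val, hc, h1, State.setN, State.setR, Rat.cast_zero, zero_sub]
      refine ⟨by simp [Function.update_of_ne hv1.symm, hc], trivial, fun w hw hw' => ?_,
        fun w hw => ?_, fun i hi hA => ?_, ?_, fun _ => ?_⟩
      · simpa [Function.update_of_ne hw'] using h2 w hw hw'
      · simpa [Function.update_of_ne hw] using h3 w hw
      · rw [Function.update_self]
        rcases Nat.lt_succ_iff_lt_or_eq.mp hi with hi | rfl
        · exact (h4 i hi hA).trans hb.2.le
        · exact le_rfl
      · simpa using h5.trans hb.2.le
      · simpa using ⟨hk, hb.1⟩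
    · intro hb
      simp only [BExp.holds, RExp.val, NExp.val, hc, h1, not_le, Rat.cast_zero, zero_sub,
        not_and, not_lt] at hb
      refine (Runs.skip ⟨hc, h1, h2, h3, fun i hi hA => ?_, h5, h6⟩).mono (by norm_num)
        (fun _ h => h)
      rcases Nat.lt_succ_iff_lt_or_eq.mp hi with hi | rfl
      · exact h4 i hi hA
      · exact hb hA
  · exact ⟨rfl, fun _ _ _ => rfl, fun _ _ => rfl, by simp, hr.ge, by simp [hr]⟩

end RealRAM

/-! ### The dual function of a diagonal problem and the final step. -/

namespace GTRS

/-- The data of a diagonal problem: the diagonals of `A₀`, `A₁`, the vectors `b₀`, `b₁` (all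
indexed by `i < n`) and `c₁`. -/
structure DiagData where
  n : ℕ
  a₀ : ℕ → ℝ
  a₁ : ℕ → ℝ
  b₀ : ℕ → ℝ
  b₁ : ℕ → ℝ
  c₁ : ℝ

namespace DiagData

variable (D : DiagData)

/-- The diagonal of `A(γ)`. -/
def diag (γ : ℝ) (i : ℕ) : ℝ := D.a₀ i + γ * D.a₁ i

/-- The minimizer of `q₀ + γ q₁`. -/
noncomputable def argmin (γ : ℝ) (i : ℕ) : ℝ := -(D.b₀ i + γ * D.b₁ i) / D.diag γ i

/-- `q₁`. -/
noncomputable def q₁ (y : ℕ → ℝ) : ℝ :=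
  D.c₁ + ∑ i ∈ Finset.range D.n, (D.a₁ i * y i + 2 * D.b₁ i) * y i

/-- `q₀` without its constant term. -/
noncomputable def q₀ (y : ℕ → ℝ) : ℝ :=
  ∑ i ∈ Finset.range D.n, (D.a₀ i * y i + 2 * D.b₀ i) * y i

/-- The derivative of the dual function. -/
noncomputable def slope (γ : ℝ) : ℝ := D.q₁ (D.argmin γ)

/-- `(α, β)` is the interval of the `γ > 0` with `A(γ) ≻ 0`; the pencil degenerates at `α` in
direction `j` and at `β` in direction `k`. -/
structure IsInterval (α β : ℝ) (j k : ℕ) : Prop where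
  pos : 0 < α
  lt : α < β
  diag_pos : ∀ γ, α < γ → γ < β → ∀ i < D.n, 0 < D.diag γ i
  diag_left : ∀ i < D.n, 0 ≤ D.diag α i
  diag_right : ∀ i < D.n, 0 ≤ D.diag β i
  left_lt : j < D.n
  right_lt : k < D.n
  left_eq : D.diag α j = 0
  right_eq : D.diag β k = 0
  left_pos : 0 < D.a₁ j
  right_neg : D.a₁ k < 0

/-- Completing the square in each coordinate around the minimizer. -/
theorem aggregate_eq {γ : ℝ} (hγ : ∀ i < D.n, 0 < D.diag γ i) (y : ℕ → ℝ) :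
    D.q₀ y + γ * D.q₁ y = D.q₀ (D.argmin γ) + γ * D.q₁ (D.argmin γ) +
      ∑ i ∈ Finset.range D.n, D.diag γ i * (y i - D.argmin γ i) ^ 2 := by
  have : ∀ i ∈ Finset.range D.n, (D.a₀ i * y i + 2 * D.b₀ i) * y i +
      γ * ((D.a₁ i * y i + 2 * D.b₁ i) * y i) =
      (D.a₀ i * D.argmin γ i + 2 * D.b₀ i) * D.argmin γ i +
      γ * ((D.a₁ i * D.argmin γ i + 2 * D.b₁ i) * D.argmin γ i) +
      D.diag γ i * (y i - D.argmin γ i) ^ 2 := by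
    intro i hi
    have h := (hγ i (Finset.mem_range.mp hi)).ne'
    have hx : D.diag γ i * D.argmin γ i = -(D.b₀ i + γ * D.b₁ i) := by
      rw [argmin]; field_simp
    simp only [diag] at hx ⊢
    linear_combination (2 * y i - 2 * D.argmin γ i) * hx
  have hs := Finset.sum_congr rfl this
  simp only [Finset.sum_add_distrib, ← Finset.mul_sum] at hs
  simp only [q₀, q₁]
  linear_combination hs

/-- The step along the `i`-th axis from `argmin γ` to the surface `q₁ = 0`. -/
noncomputable def step (γ : ℝ) (i : ℕ) : ℝ :=
  (-(D.a₁ i * D.argmin γ i + D.b₁ i) +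
    (if 0 ≤ D.a₁ i * D.argmin γ i + D.b₁ i then 1 else -1) *
      √((D.a₁ i * D.argmin γ i + D.b₁ i) ^ 2 - D.a₁ i * D.slope γ)) / D.a₁ i

/-- The sign hypothesis makes the discriminant nonnegative. The sign in `step` selects the root `t`
of smaller modulus, for which `g · (a t) ≥ 0`. Multiplying the equation by `a` gives `a² t² = -a h -
2 g a t`, and the last term can be dropped. -/
theorem step_spec {γ : ℝ} {i : ℕ} (ha : D.a₁ i ≠ 0) (hs : D.a₁ i * D.slope γ ≤ 0) :
    D.slope γ + 2 * (D.a₁ i * D.argmin γ i + D.b₁ i) * D.step γ i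
      + D.a₁ i * D.step γ i ^ 2 = 0 ∧
    D.a₁ i ^ 2 * D.step γ i ^ 2 ≤ -(D.a₁ i * D.slope γ) := by
  set g := D.a₁ i * D.argmin γ i + D.b₁ i with hg
  set h := D.slope γ
  set a := D.a₁ i
  set σ : ℝ := if 0 ≤ g then 1 else -1 with hσ
  set S := √(g ^ 2 - a * h) with hS
  have hSS : S ^ 2 = g ^ 2 - a * h := Real.sq_sqrt (by nlinarith [sq_nonneg g])
  have hσ2 : σ ^ 2 = 1 := by rw [hσ]; split_ifs <;> norm_num
  have hσg : σ * g = |g| := by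
    rw [hσ]; split_ifs with h0
    · rw [abs_of_nonneg h0, one_mul]
    · rw [abs_of_neg (not_le.mp h0)]; ring
  have hgS : |g| ≤ S := Real.abs_le_sqrt (by linarith)
  have ht : a * D.step γ i = -g + σ * S := by
    rw [step, mul_div_cancel₀ _ ha]
  set t := D.step γ i
  have hq : a * (h + 2 * g * t + a * t ^ 2) = 0 := by
    have : (a * t + g) ^ 2 = g ^ 2 - a * h := by rw [ht, ← hSS]; linear_combination S ^ 2 * hσ2
    linear_combination this
  have hq' := (mul_eq_zero.mp hq).resolve_left ha
  refine ⟨hq', ?_⟩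
  have hpos : 0 ≤ g * (a * t) := by
    have : g * (a * t) = |g| * S - |g| ^ 2 := by
      rw [ht, sq_abs, ← hσg]; ring
    rw [this]; nlinarith [abs_nonneg g]
  nlinarith

theorem sum_update {x : ℕ → ℝ} {i : ℕ} (hi : i < D.n) (t : ℝ) (f : ℕ → ℝ → ℝ) :
    ∑ k ∈ Finset.range D.n, f k (Function.update x i (x i + t) k) =
      ∑ k ∈ Finset.range D.n, f k (x k) + (f i (x i + t) - f i (x i)) := by
  rw [← Finset.add_sum_erase _ _ (Finset.mem_range.mpr hi),
    ← Finset.add_sum_erase _ (fun k => f k (x k)) (Finset.mem_range.mpr hi),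
    Function.update_self, Finset.sum_congr rfl fun k hk => by
      rw [Function.update_of_ne (Finset.ne_of_mem_erase hk)]]
  ring

/-- Moving from `argmin γ` along an axis to the surface `q₁ = 0`. -/
theorem q₁_update_step {γ : ℝ} {i : ℕ} (hi : i < D.n) (ha : D.a₁ i ≠ 0)
    (hs : D.a₁ i * D.slope γ ≤ 0) :
    D.q₁ (Function.update (D.argmin γ) i (D.argmin γ i + D.step γ i)) = 0 := by
  rw [q₁, D.sum_update hi _ fun k z => (D.a₁ k * z + 2 * D.b₁ k) * z]
  have h := (D.step_spec ha hs).1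
  rw [slope, q₁] at h
  linear_combination h

/-- Weak duality: `q₀ y` is at least the minimum of the aggregate for feasible `y`, while at the
moved point `q₁` vanishes and the aggregate exceeds its minimum only by the square in coordinate
`i`. -/
theorem q₀_update_step_le {γ : ℝ} {i : ℕ} (hγ0 : 0 ≤ γ) (hγ : ∀ i < D.n, 0 < D.diag γ i)
    (hi : i < D.n) (ha : D.a₁ i ≠ 0) (hs : D.a₁ i * D.slope γ ≤ 0) {e : ℝ}
    (he : D.diag γ i * D.step γ i ^ 2 ≤ e) {y : ℕ → ℝ} (hy : D.q₁ y ≤ 0) :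
    D.q₀ (Function.update (D.argmin γ) i (D.argmin γ i + D.step γ i)) ≤ D.q₀ y + e := by
  have h1 := D.aggregate_eq hγ (Function.update (D.argmin γ) i (D.argmin γ i + D.step γ i))
  have h2 := D.aggregate_eq hγ y
  rw [D.q₁_update_step hi ha hs,
    D.sum_update hi _ fun k z => D.diag γ k * (z - D.argmin γ k) ^ 2] at h1
  have h3 : 0 ≤ ∑ i ∈ Finset.range D.n, D.diag γ i * (y i - D.argmin γ i) ^ 2 :=
    Finset.sum_nonneg fun i hi =>
      mul_nonneg (hγ i (Finset.mem_range.mp hi)).le (sq_nonneg _)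
  simp at h1
  nlinarith [mul_nonneg hγ0 (neg_nonneg.mpr hy)]

/-- The step along a direction in which the pencil degenerates at `δ` is short. -/
theorem diag_mul_step_sq_le {γ δ e : ℝ} {i : ℕ} (ha : D.a₁ i ≠ 0) (hδ : D.diag δ i = 0)
    (hs : D.a₁ i * D.slope γ ≤ 0) (hγ : 0 ≤ D.diag γ i) (he : (δ - γ) * D.slope γ ≤ e) :
    D.diag γ i * D.step γ i ^ 2 ≤ e := by
  have h := (D.step_spec ha hs).2
  -- The entry is affine in the parameter and vanishes at `δ`; the factor `a₁ i` here cancels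
  -- against the bound on the squared step.
  have h1 : D.diag γ i = (γ - δ) * D.a₁ i := by rw [diag] at *; linarith
  have h2 : 0 < D.a₁ i ^ 2 := by positivity
  have h3 : D.a₁ i ^ 2 * (D.diag γ i * D.step γ i ^ 2) ≤ D.a₁ i ^ 2 * e := by
    calc D.a₁ i ^ 2 * (D.diag γ i * D.step γ i ^ 2)
        = D.diag γ i * (D.a₁ i ^ 2 * D.step γ i ^ 2) := by ring
      _ ≤ D.diag γ i * -(D.a₁ i * D.slope γ) := mul_le_mul_of_nonneg_left h hγ
      _ = D.a₁ i ^ 2 * ((δ - γ) * D.slope γ) := by rw [h1]; ring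
      _ ≤ _ := mul_le_mul_of_nonneg_left he h2.le
  exact le_of_mul_le_mul_left h3 h2

/-! ### The modulus of continuity of the slope -/

/-- An exact formula: the nonnegative weights `(b₁a₀ - a₁b₀)²` do not depend on the parameter, so
monotonicity and both comparisons below reduce to estimates of the diagonal entries. -/
theorem slope_sub_slope {s t : ℝ} (hs : ∀ i < D.n, 0 < D.diag s i)
    (ht : ∀ i < D.n, 0 < D.diag t i) :
    D.slope s - D.slope t = (t - s) * ∑ i ∈ Finset.range D.n,
      (D.b₁ i * D.a₀ i - D.a₁ i * D.b₀ i) ^ 2 * (D.diag s i + D.diag t i) /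
        (D.diag s i ^ 2 * D.diag t i ^ 2) := by
  simp only [slope, q₁, add_sub_add_left_eq_sub]
  rw [← Finset.sum_sub_distrib, Finset.mul_sum]
  refine Finset.sum_congr rfl fun i hi => ?_
  have h1 := (hs i (Finset.mem_range.mp hi)).ne'
  have h2 := (ht i (Finset.mem_range.mp hi)).ne'
  simp only [argmin]
  field_simp
  simp only [diag]
  ring

variable {D} {α β : ℝ} {j k : ℕ}

theorem IsInterval.slope_antitone (hI : D.IsInterval α β j k) {s t : ℝ} (hs : α < s)
    (hst : s ≤ t) (ht : t < β) : D.slope t ≤ D.slope s := by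
  have h1 := hI.diag_pos s hs (hst.trans_lt ht)
  have h2 := hI.diag_pos t (hs.trans_le hst) ht
  have := D.slope_sub_slope h1 h2
  have h3 : 0 ≤ (t - s) * ∑ i ∈ Finset.range D.n,
      (D.b₁ i * D.a₀ i - D.a₁ i * D.b₀ i) ^ 2 * (D.diag s i + D.diag t i) /
        (D.diag s i ^ 2 * D.diag t i ^ 2) := by
    refine mul_nonneg (by linarith) (Finset.sum_nonneg fun i hi => ?_)
    have := h1 i (Finset.mem_range.mp hi)
    have := h2 i (Finset.mem_range.mp hi)
    positivity
  linarith

/-- At distance `d` from the end points of `(α, β)`, each diagonal entry has at least the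
fraction `2 d / (β - α)` of its value at the midpoint. -/
theorem IsInterval.mul_diag_mid_le (hI : D.IsInterval α β j k) {s d : ℝ} (h1 : d ≤ s - α)
    (h2 : d ≤ β - s) {i : ℕ} (hi : i < D.n) :
    2 * d * D.diag ((α + β) / 2) i ≤ (β - α) * D.diag s i := by
  have e1 := hI.diag_left i hi
  have e2 := hI.diag_right i hi
  have : (β - α) * D.diag s i = (β - s) * D.diag α i + (s - α) * D.diag β i := by
    simp only [diag]; ring
  have h3 : 2 * D.diag ((α + β) / 2) i = D.diag α i + D.diag β i := by simp only [diag]; ring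
  calc 2 * d * D.diag ((α + β) / 2) i = d * D.diag α i + d * D.diag β i := by
        linear_combination d * h3
    _ ≤ _ := by rw [this]; gcongr

theorem IsInterval.diag_le (hI : D.IsInterval α β j k) {s : ℝ} (h1 : α ≤ s)
    (h2 : s ≤ β) {i : ℕ} (hi : i < D.n) :
    D.diag s i ≤ 2 * D.diag ((α + β) / 2) i := by
  have e1 := hI.diag_left i hi
  have e2 := hI.diag_right i hi
  have hw := sub_pos.mpr hI.lt
  have : (β - α) * D.diag s i = (β - s) * D.diag α i + (s - α) * D.diag β i := by
    simp only [diag]; ring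
  have h3 : 2 * D.diag ((α + β) / 2) i = D.diag α i + D.diag β i := by simp only [diag]; ring
  refine le_of_mul_le_mul_left ?_ hw
  rw [this, h3]
  nlinarith [mul_nonneg (sub_nonneg.mpr h1) e1, mul_nonneg (sub_nonneg.mpr h2) e2]

/-- Each term has three inverse diagonal factors; `mul_diag_mid_le` trades each for its midpoint
value at the price `(β - α)/(2d)`. -/
theorem IsInterval.slope_sub_le_sum (hI : D.IsInterval α β j k) {s t d : ℝ} (hd : 0 < d)
    (h1 : d ≤ s - α) (hst : s ≤ t) (h2 : d ≤ β - t) :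
    D.slope s - D.slope t ≤ (t - s) * ((β - α) ^ 3 / (4 * d ^ 3) *
      ∑ i ∈ Finset.range D.n, (D.b₁ i * D.a₀ i - D.a₁ i * D.b₀ i) ^ 2 /
        D.diag ((α + β) / 2) i ^ 3) := by
  have p1 := hI.diag_pos s (by linarith) (by linarith)
  have p2 := hI.diag_pos t (by linarith) (by linarith)
  have p0 := hI.diag_pos ((α + β) / 2) (by linarith [hI.lt]) (by linarith [hI.lt])
  have hw := sub_pos.mpr hI.lt
  rw [D.slope_sub_slope p1 p2]
  refine mul_le_mul_of_nonneg_left ?_ (by linarith)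
  rw [Finset.mul_sum]
  refine Finset.sum_le_sum fun i hi => ?_
  have hi := Finset.mem_range.mp hi
  have q1 := p1 i hi
  have q2 := p2 i hi
  have q0 := p0 i hi
  have m1 := hI.mul_diag_mid_le h1 (by linarith) hi
  have m2 := hI.mul_diag_mid_le (s := t) (by linarith) h2 hi
  generalize D.diag s i = x at *
  generalize D.diag t i = y at *
  generalize D.diag ((α + β) / 2) i = z at *
  have hR := sq_nonneg (D.b₁ i * D.a₀ i - D.a₁ i * D.b₀ i)
  generalize (D.b₁ i * D.a₀ i - D.a₁ i * D.b₀ i) ^ 2 = R at *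
  have inv : ∀ x, 0 < x → 2 * d * z ≤ (β - α) * x → 1 / x ≤ (β - α) / (2 * d * z) := by
    intro x hx h
    rw [div_le_div_iff₀ hx (by positivity)]
    linarith
  have i1 := inv x q1 m1
  have i2 := inv y q2 m2
  have hc : 0 ≤ (β - α) / (2 * d * z) := by positivity
  calc R * (x + y) / (x ^ 2 * y ^ 2) = R * (1 / x * (1 / y) * (1 / x + 1 / y)) := by
        field_simp; ring
    _ ≤ R * ((β - α) / (2 * d * z) * ((β - α) / (2 * d * z)) *
          ((β - α) / (2 * d * z) + (β - α) / (2 * d * z))) := by gcongr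
    _ = _ := by field_simp; ring

/-- The converse comparison: between the quarter points `p`, `q` the slope drops by at most `2H`,
and this drop bounds the midpoint sum from above. -/
theorem IsInterval.sum_le (hI : D.IsInterval α β j k) {H : ℝ}
    (hH : ∀ s, (β - α) / 4 ≤ s - α → (β - α) / 4 ≤ β - s → |D.slope s| ≤ H) :
    (β - α) * ∑ i ∈ Finset.range D.n, (D.b₁ i * D.a₀ i - D.a₁ i * D.b₀ i) ^ 2 /
        D.diag ((α + β) / 2) i ^ 3 ≤ 12 * H := by
  have hw := sub_pos.mpr hI.lt
  obtain ⟨p, hp⟩ : ∃ p, p = α + (β - α) / 4 := ⟨_, rfl⟩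
  obtain ⟨q, hq⟩ : ∃ q, q = β - (β - α) / 4 := ⟨_, rfl⟩
  have p1 := hI.diag_pos p (by linarith) (by linarith)
  have p2 := hI.diag_pos q (by linarith) (by linarith)
  have p0 := hI.diag_pos ((α + β) / 2) (by linarith [hI.lt]) (by linarith [hI.lt])
  have b1 := abs_le.mp (hH p (by linarith) (by linarith))
  have b2 := abs_le.mp (hH q (by linarith) (by linarith))
  have hs := D.slope_sub_slope p1 p2
  have hle : (1 / 3) * ∑ i ∈ Finset.range D.n, (D.b₁ i * D.a₀ i - D.a₁ i * D.b₀ i) ^ 2 /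
        D.diag ((α + β) / 2) i ^ 3 ≤ ∑ i ∈ Finset.range D.n,
      (D.b₁ i * D.a₀ i - D.a₁ i * D.b₀ i) ^ 2 * (D.diag p i + D.diag q i) /
        (D.diag p i ^ 2 * D.diag q i ^ 2) := by
    rw [Finset.mul_sum]
    refine Finset.sum_le_sum fun i hi => ?_
    have hi := Finset.mem_range.mp hi
    have q1 := p1 i hi
    have q2 := p2 i hi
    have q0 := p0 i hi
    have e : D.diag p i + D.diag q i = 2 * D.diag ((α + β) / 2) i := by
      simp only [diag, hp, hq]; ring
    have hR := sq_nonneg (D.b₁ i * D.a₀ i - D.a₁ i * D.b₀ i)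
    generalize D.diag p i = x at *
    generalize D.diag q i = y at *
    generalize D.diag ((α + β) / 2) i = z at *
    generalize (D.b₁ i * D.a₀ i - D.a₁ i * D.b₀ i) ^ 2 = R at *
    -- AM–GM, as the quarter points are symmetric about the midpoint and so `x + y = 2z`.
    have hxy : x * y ≤ z ^ 2 := by nlinarith [sq_nonneg (x - y)]
    have hxy' : x ^ 2 * y ^ 2 ≤ z ^ 4 := by
      calc x ^ 2 * y ^ 2 = (x * y) ^ 2 := by ring
        _ ≤ (z ^ 2) ^ 2 := by gcongr
        _ = z ^ 4 := by ring
    rw [e]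
    calc 1 / 3 * (R / z ^ 3) ≤ 2 * (R / z ^ 3) := by
          have : 0 ≤ R / z ^ 3 := by positivity
          linarith
      _ = R * (2 * z) / z ^ 4 := by field_simp
      _ ≤ R * (2 * z) / (x ^ 2 * y ^ 2) := by gcongr
  have hd : q - p = (β - α) / 2 := by linarith
  rw [hd] at hs
  have := mul_le_mul_of_nonneg_left hle (by linarith : 0 ≤ (β - α) / 2)
  rw [← hs] at this
  linarith

theorem IsInterval.slope_sub_le (hI : D.IsInterval α β j k) {H : ℝ}
    (hH : ∀ s, (β - α) / 4 ≤ s - α → (β - α) / 4 ≤ β - s → |D.slope s| ≤ H)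
    {s t d : ℝ} (hd : 0 < d) (h1 : d ≤ s - α) (hst : s ≤ t) (h2 : d ≤ β - t) :
    D.slope s - D.slope t ≤ (t - s) * (3 * H * (β - α) ^ 2 / d ^ 3) := by
  have hw := sub_pos.mpr hI.lt
  refine (hI.slope_sub_le_sum hd h1 hst h2).trans
    (mul_le_mul_of_nonneg_left ?_ (by linarith))
  have := mul_le_mul_of_nonneg_left (hI.sum_le hH)
    (by positivity : 0 ≤ (β - α) ^ 2 / (4 * d ^ 3))
  calc _ = (β - α) ^ 2 / (4 * d ^ 3) * ((β - α) * ∑ i ∈ Finset.range D.n,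
        (D.b₁ i * D.a₀ i - D.a₁ i * D.b₀ i) ^ 2 / D.diag ((α + β) / 2) i ^ 3) := by
        field_simp
    _ ≤ _ := this
    _ = _ := by field_simp; ring

end DiagData

/-! ### Bisection and the number of halvings. -/

/-- In a bracket `[l, u]` right of the midpoint of `(α, β)` whose end points fail the
termination test, the length of the bracket is bounded below. -/
theorem bracket_length {f : ℝ → ℝ} {α β H ε l u : ℝ} (hε : 0 < ε)
    (hH : f ((α + β) / 2) ≤ H)
    (anti : ∀ s t, α < s → s ≤ t → t < β → f t ≤ f s)
    (lip : ∀ s t d, 0 < d → d ≤ s - α → s ≤ t → d ≤ β - t →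
      f s - f t ≤ (t - s) * (3 * H * (β - α) ^ 2 / d ^ 3))
    (hl : (α + β) / 2 ≤ l) (hlu : l < u) (hu : u ≤ β) (hαβ : α < β)
    (hεl : ε < (β - l) * f l) (hfu : u = β ∨ f u ≤ 0) :
    ε < 2 * (u - l) * H ∨ ε ^ 3 < 24 * (u - l) * H ^ 3 * (β - α) ^ 2 := by
  have hδ : 0 < β - l := by linarith
  have hfl : f l ≤ H := (anti _ _ (by linarith) hl (by linarith)).trans hH
  have hεH : ε < (β - l) * H := hεl.trans_le (by gcongr)
  have hH0 : 0 < H := by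
    by_contra! h
    nlinarith
  -- Either the bracket fills more than half of `[l, β]`, or `u` stays at least `(β - l)/2` away
  -- from `β` and the Lipschitz bound applies with that distance; the same distance from `α` is
  -- assured because `l` is right of the midpoint.
  by_cases hc : β - l < 2 * (u - l)
  · left
    nlinarith
  · right
    push Not at hc
    have hu' : f u ≤ 0 := hfu.resolve_left (by rintro rfl; linarith)
    have h := lip l u ((β - l) / 2) (by linarith) (by linarith) hlu.le (by linarith)
    have h1 : f l ≤ (u - l) * (3 * H * (β - α) ^ 2 / ((β - l) / 2) ^ 3) := by linarith
    have h2 : ε < (β - l) * ((u - l) * (3 * H * (β - α) ^ 2 / ((β - l) / 2) ^ 3)) :=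
      hεl.trans_le (mul_le_mul_of_nonneg_left h1 hδ.le)
    have h3 : (β - l) * ((u - l) * (3 * H * (β - α) ^ 2 / ((β - l) / 2) ^ 3)) =
        24 * (u - l) * H * (β - α) ^ 2 / (β - l) ^ 2 := by field_simp; ring
    rw [h3, lt_div_iff₀ (by positivity)] at h2
    have h4 : ε ^ 2 ≤ (β - l) ^ 2 * H ^ 2 := by
      rw [← mul_pow]; gcongr
    calc ε ^ 3 = ε * ε ^ 2 := by ring
      _ ≤ ε * ((β - l) ^ 2 * H ^ 2) := by gcongr
      _ = (ε * (β - l) ^ 2) * H ^ 2 := by ring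
      _ < (24 * (u - l) * H * (β - α) ^ 2) * H ^ 2 := by gcongr
      _ = _ := by ring

/-- The invariant of the bisection after `k` halvings. -/
structure Bracket (f : ℝ → ℝ) (α β ε : ℝ) (k : ℕ) (l u : ℝ) : Prop where
  le_left : α ≤ l
  right_le : u ≤ β
  length : u - l = (β - α) / 2 ^ k
  left : l = α ∨ (0 < f l ∧ ε < (β - l) * f l)
  right : u = β ∨ (f u ≤ 0 ∧ ε < (u - α) * -f u)
  side : k = 0 ∨ (α + β) / 2 ≤ l ∨ u ≤ (α + β) / 2

/-- The lower bound on the bracket length, combined with its exact value `(β - α)/2^k`. -/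
theorem Bracket.two_pow_lt {f : ℝ → ℝ} {α β H ε l u : ℝ} {k : ℕ}
    (hB : Bracket f α β ε k l u) (hε : 0 < ε)
    (hH : |f ((α + β) / 2)| ≤ H)
    (anti : ∀ s t, α < s → s ≤ t → t < β → f t ≤ f s)
    (lip : ∀ s t d, 0 < d → d ≤ s - α → s ≤ t → d ≤ β - t →
      f s - f t ≤ (t - s) * (3 * H * (β - α) ^ 2 / d ^ 3)) (hαβ : α < β) :
    (2 : ℝ) ^ k < 24 * max 1 (H * (β - α) / ε) ^ 3 := by
  have hw := sub_pos.mpr hαβ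
  have hlu : l < u := by
    have : 0 < u - l := by rw [hB.length]; positivity
    linarith
  have h1 : 1 ≤ max 1 (H * (β - α) / ε) ^ 3 := one_le_pow₀ (le_max_left _ _)
  obtain ⟨hH1, hH2⟩ := abs_le.mp hH
  have key : ε < 2 * (u - l) * H ∨ ε ^ 3 < 24 * (u - l) * H ^ 3 * (β - α) ^ 2 →
      (2 : ℝ) ^ k < 24 * max 1 (H * (β - α) / ε) ^ 3 := by
    rw [hB.length]
    have hm : H * (β - α) / ε ≤ max 1 (H * (β - α) / ε) := le_max_right _ _
    have h2k : (0 : ℝ) < 2 ^ k := by positivity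
    rintro (h | h)
    · have : (2 : ℝ) ^ k < 2 * (H * (β - α) / ε) := by
        rw [← mul_div_assoc, lt_div_iff₀ hε]
        have h' : ε < 2 * (H * (β - α)) / 2 ^ k := by
          convert h using 1; ring
        rw [lt_div_iff₀ h2k] at h'
        linarith
      have h3 : max 1 (H * (β - α) / ε) ≤ max 1 (H * (β - α) / ε) ^ 3 :=
        le_self_pow₀ (le_max_left _ _) (by norm_num)
      linarith
    · have : (2 : ℝ) ^ k < 24 * (H * (β - α) / ε) ^ 3 := by
        rw [div_pow, ← mul_div_assoc, lt_div_iff₀ (by positivity)]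
        have h' : ε ^ 3 < 24 * (H * (β - α)) ^ 3 / 2 ^ k := by
          convert h using 1; ring
        rw [lt_div_iff₀ h2k] at h'
        linarith
      have h3 : (H * (β - α) / ε) ^ 3 ≤ max 1 (H * (β - α) / ε) ^ 3 := by
        have : 0 ≤ H * (β - α) / ε := by
          have : 0 ≤ H := (abs_nonneg _).trans hH
          positivity
        gcongr
      linarith
  rcases hB.side with rfl | hs | hs
  · linarith
  · refine key (bracket_length hε hH2 anti lip hs hlu hB.right_le hαβ ?_ ?_)
    · exact (hB.left.resolve_left (by rintro rfl; linarith)).2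
    · exact hB.right.imp id And.left
  · refine key ?_
    -- A bracket left of the midpoint is reflected by `s ↦ α + β - s`; negating `f` restores
    -- antitonicity.
    have := bracket_length (f := fun s => -f (α + β - s)) (α := α) (β := β) (H := H) (ε := ε)
      (l := α + β - u) (u := α + β - l) hε ?_ ?_ ?_ (by linarith) (by linarith)
      (by linarith [hB.le_left]) hαβ ?_ ?_
    · rwa [show α + β - l - (α + β - u) = u - l by ring] at this
    · rw [show α + β - (α + β) / 2 = (α + β) / 2 by ring]; linarith
    · intro s t h1 h2 h3
      have := anti (α + β - t) (α + β - s) (by linarith) (by linarith) (by linarith)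
      simpa using this
    · intro s t d hd h1 h2 h3
      have := lip (α + β - t) (α + β - s) d hd (by linarith) (by linarith) (by linarith)
      rw [show α + β - s - (α + β - t) = t - s by ring] at this
      linarith
    · have := (hB.right.resolve_left (by rintro rfl; linarith)).2
      simp only [sub_sub_cancel]
      rwa [show β - (α + β - u) = u - α by ring]
    · rcases hB.left with h | h
      · left; rw [h]; ring
      · right; simpa using h.1.le

/-- One step of the bisection. -/
theorem Bracket.halve {f : ℝ → ℝ} {α β ε l u m : ℝ} {k : ℕ} (hB : Bracket f α β ε k l u)
    (hε : 0 < ε) (hαβ : α < β) (hm : m = (l + u) / 2)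
    (h : ¬ ((β - m) * f m ≤ ε ∧ (m - α) * -f m ≤ ε)) :
    (0 < f m → Bracket f α β ε (k + 1) m u) ∧ (¬ 0 < f m → Bracket f α β ε (k + 1) l m) := by
  have hw := sub_pos.mpr hαβ
  have hlen := hB.length
  have hlu : 0 < u - l := by rw [hlen]; positivity
  have h1 := hB.le_left
  have h2 := hB.right_le
  have hlen' : (β - α) / 2 ^ (k + 1) = (u - l) / 2 := by rw [hlen, pow_succ]; field_simp
  constructor
  · intro hf
    refine ⟨by linarith, h2, by rw [hlen']; linarith, .inr ⟨hf, ?_⟩, hB.right, .inr ?_⟩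
    -- Where `f m > 0` the other half of the test holds trivially, so this half must be the one that
    -- failed.
    · by_contra! hc
      exact h ⟨hc, by nlinarith [hε]⟩
    -- Before any halving the bracket is all of `[α, β]`, so `m` is the midpoint; afterwards a
    -- bracket stays on its side.
    · rcases hB.side with rfl | hs | hs
      · left
        norm_num at hlen
        linarith
      · left; linarith
      · right; linarith
  · intro hf
    refine ⟨h1, by linarith, by rw [hlen']; linarith, hB.left, .inr ⟨not_lt.mp hf, ?_⟩, .inr ?_⟩
    · by_contra! hc
      exact h ⟨by nlinarith [hε], hc⟩
    · rcases hB.side with rfl | hs | hs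
      · right
        norm_num at hlen
        linarith
      · left; linarith
      · right; linarith

end GTRS

namespace GTRS
open RealRAM

/-! ### From matrices to diagonal data, and the constants `γ₊`, `ξ*`, `κ*`. -/

/-- The diagonal data of a pair of quadratic functions. -/
noncomputable def diagData {n : ℕ} (q₀ q₁ : QuadFun n) : DiagData where
  n := n
  a₀ := ofVec q₀.A.diag
  a₁ := ofVec q₁.A.diag
  b₀ := ofVec q₀.b
  b₁ := ofVec q₁.b
  c₁ := q₁.c

variable {n : ℕ} {q₀ q₁ : QuadFun n}

theorem ofVec_fin (v : Fin n → ℝ) (i : Fin n) : ofVec v i = v i := by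
  simp [ofVec]

theorem eval_eq {q : QuadFun n} (hq : q.A.IsDiag) (x : EuclideanSpace ℝ (Fin n)) (y : ℕ → ℝ)
    (hxy : ∀ i : Fin n, x i = y i) :
    q.eval x = q.c + ∑ i ∈ Finset.range n, (ofVec q.A.diag i * y i + 2 * ofVec q.b i) * y i := by
  obtain ⟨d, hd⟩ : ∃ d, q.A = Matrix.diagonal d := ⟨_, hq.diagonal_diag.symm⟩
  rw [Finset.sum_range, QuadFun.eval, hd, add_comm]
  congr 1
  simp only [PiLp.inner_apply, Matrix.toLpLin_apply, Matrix.mulVec_diagonal, ofVec_fin,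
    Matrix.diag_diagonal, Finset.mul_sum]
  rw [← Finset.sum_add_distrib]
  refine Finset.sum_congr rfl fun i _ => ?_
  simp only [← hxy]
  simp
  ring

theorem pencil_eq (h₀ : q₀.A.IsDiag) (h₁ : q₁.A.IsDiag) (γ : ℝ) :
    pencil q₀ q₁ γ = Matrix.diagonal fun i : Fin n => (diagData q₀ q₁).diag γ i := by
  rw [pencil, ← h₀.diagonal_diag, ← h₁.diagonal_diag, Matrix.smul_eq_diagonal_mul,
    Matrix.diagonal_mul_diagonal, Matrix.diagonal_add]
  congr 1
  ext i
  simp [DiagData.diag, diagData, ofVec_fin]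

theorem lambdaMin_diagonal_le (d : Fin n → ℝ) (i : Fin n) :
    lambdaMin (Matrix.diagonal d) ≤ d i := by
  rw [lambdaMin, spectrum_diagonal]
  exact csInf_le (Set.finite_range d).bddBelow ⟨i, rfl⟩

theorem lambdaMin_diagonal_pos (hn : 0 < n) {d : Fin n → ℝ} (hd : ∀ i, 0 < d i) :
    0 < lambdaMin (Matrix.diagonal d) := by
  have : Nonempty (Fin n) := ⟨⟨0, hn⟩⟩
  rw [lambdaMin, spectrum_diagonal]
  obtain ⟨i, hi⟩ := (Set.range_nonempty d).csInf_mem (Set.finite_range d)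
  rw [← hi]
  exact hd i

theorem abs_diag_le (A : Matrix (Fin n) (Fin n) ℝ) (i : Fin n) :
    |A i i| ≤ spectralNorm₂ A := by
  have h := (Matrix.toEuclideanCLM (n := Fin n) (𝕜 := ℝ) A).le_opNorm
    (EuclideanSpace.single i 1)
  have h2 := PiLp.norm_apply_le (Matrix.toEuclideanCLM (n := Fin n) (𝕜 := ℝ) A
    (EuclideanSpace.single i 1)) i
  have h3 : (Matrix.toEuclideanCLM (n := Fin n) (𝕜 := ℝ) A
    (EuclideanSpace.single i 1)) i = A i i := by
    simp
  rw [h3, Real.norm_eq_abs] at h2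
  simpa [spectralNorm₂] using h2.trans h

theorem sum_sq_le {v : EuclideanSpace ℝ (Fin n)} (hv : ‖v‖ ≤ 1) :
    ∑ i ∈ Finset.range n, ofVec v i ^ 2 ≤ 1 := by
  rw [Finset.sum_range]
  simp only [ofVec_fin]
  rw [← EuclideanSpace.real_norm_sq_eq]
  exact pow_le_one₀ (norm_nonneg _) hv

/-- The end points of the interval from the two largest ratios. -/
theorem DiagData.isInterval_of_ratios {D : DiagData} {γ : ℝ} (hγ : 0 ≤ γ)
    (hpos : ∀ i < D.n, 0 < D.diag γ i) (h₀ : ∃ i < D.n, D.a₀ i < 0) (h₁ : ∃ i < D.n, D.a₁ i < 0)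
    {α ρ : ℝ} {j k : ℕ} (hα : ∀ i < D.n, 0 < D.a₁ i → -D.a₀ i / D.a₁ i ≤ α)
    (hj : 0 < α → j < D.n ∧ 0 < D.a₁ j ∧ α = -D.a₀ j / D.a₁ j)
    (hρ : ∀ i < D.n, 0 < D.a₀ i → -D.a₁ i / D.a₀ i ≤ ρ)
    (hk : 0 < ρ → k < D.n ∧ 0 < D.a₀ k ∧ ρ = -D.a₁ k / D.a₀ k) :
    D.IsInterval α (1 / ρ) j k := by
  simp only [diag] at hpos
  have hα0 : 0 < α := by
    -- A negative entry of `A₀` forces a positive entry of `A₁` in the same place, hence a positive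
    -- ratio. By symmetry `ρ > 0`, so `β = 1/ρ` is found by the same maximization with the two
    -- diagonals exchanged.
    obtain ⟨i, hi, h⟩ := h₀
    have h2 : 0 < D.a₁ i := pos_of_mul_pos_right (by linarith [hpos i hi] : 0 < γ * D.a₁ i) hγ
    exact (div_pos (neg_pos.mpr h) h2).trans_le (hα i hi h2)
  have hρ0 : 0 < ρ := by
    obtain ⟨i, hi, h⟩ := h₁
    have h2 : 0 < D.a₀ i := by nlinarith [hpos i hi]
    exact (div_pos (neg_pos.mpr h) h2).trans_le (hρ i hi h2)
  obtain ⟨hj1, hj2, hj3⟩ := hj hα0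
  obtain ⟨hk1, hk2, hk3⟩ := hk hρ0
  have hj4 : D.a₀ j + α * D.a₁ j = 0 := by rw [hj3]; field_simp; ring
  have hk4 : D.a₀ k * ρ + D.a₁ k = 0 := by rw [hk3]; field_simp; ring
  have hk5 : D.a₁ k < 0 := by nlinarith [mul_pos hk2 hρ0]
  have hαγ : α < γ := by
    have : 0 < (γ - α) * D.a₁ j := by linarith [hpos j hj1]
    linarith [pos_of_mul_pos_left this hj2.le]
  have hk6 : D.a₀ k + 1 / ρ * D.a₁ k = 0 := by field_simp; linarith
  have hγβ : γ < 1 / ρ := by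
    have : 0 < (1 / ρ - γ) * -D.a₁ k := by linarith [hpos k hk1]
    linarith [pos_of_mul_pos_left this (neg_pos.mpr hk5).le]
  have hleft : ∀ i < D.n, 0 ≤ D.diag α i := by
    intro i hi
    simp only [diag]
    rcases lt_or_ge 0 (D.a₁ i) with h | h
    · have := hα i hi h
      rw [div_le_iff₀ h] at this
      linarith
    · nlinarith [hpos i hi]
  have hright : ∀ i < D.n, 0 ≤ D.diag (1 / ρ) i := by
    intro i hi
    simp only [diag]
    rcases lt_or_ge 0 (D.a₀ i) with h | h
    · have := hρ i hi h
      rw [div_le_iff₀ h] at this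
      have h2 : 0 ≤ (D.a₀ i * ρ + D.a₁ i) / ρ := div_nonneg (by linarith) hρ0.le
      convert h2 using 1
      field_simp
    · have h2 : 0 < D.a₁ i := pos_of_mul_pos_right (by linarith [hpos i hi] : 0 < γ * D.a₁ i) hγ
      nlinarith [hpos i hi]
  refine ⟨hα0, hαγ.trans hγβ, fun δ h1 h2 i hi => ?_, hleft, hright, hj1, hk1, hj4, hk6,
    hj2, hk5⟩
  have l := hleft i hi
  have r := hright i hi
  have m := hpos i hi
  simp only [diag] at l r ⊢
  rcases le_total δ γ with h | h
  · have : 0 < (γ - α) * (D.a₀ i + δ * D.a₁ i) := by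
      have : (γ - α) * (D.a₀ i + δ * D.a₁ i) =
        (γ - δ) * (D.a₀ i + α * D.a₁ i) + (δ - α) * (D.a₀ i + γ * D.a₁ i) := by ring
      rw [this]
      have := mul_nonneg (sub_nonneg.mpr h) l
      have := mul_pos (sub_pos.mpr h1) m
      linarith
    exact pos_of_mul_pos_right this (by linarith)
  · have : 0 < (1 / ρ - γ) * (D.a₀ i + δ * D.a₁ i) := by
      have : (1 / ρ - γ) * (D.a₀ i + δ * D.a₁ i) =
        (δ - γ) * (D.a₀ i + 1 / ρ * D.a₁ i) + (1 / ρ - δ) * (D.a₀ i + γ * D.a₁ i) := by ring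
      rw [this]
      have := mul_nonneg (sub_nonneg.mpr h) r
      have := mul_pos (sub_pos.mpr h2) m
      linarith
    exact pos_of_mul_pos_right this (by linarith)

theorem exists_diag_neg {q : QuadFun n} (hq : q.A.IsDiag)
    (h : ∃ μ ∈ spectrum ℝ q.A, μ < 0) : ∃ i < n, ofVec q.A.diag i < 0 := by
  obtain ⟨μ, hμ, h0⟩ := h
  rw [← hq.diagonal_diag, spectrum_diagonal] at hμ
  obtain ⟨i, rfl⟩ := hμ
  exact ⟨i, i.2, by rwa [ofVec_fin]⟩

theorem exists_diag_pos (hA : Assumption q₀ q₁) (h₀ : q₀.A.IsDiag) (h₁ : q₁.A.IsDiag) :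
    ∃ γ, 0 ≤ γ ∧ ∀ i < n, 0 < (diagData q₀ q₁).diag γ i := by
  obtain ⟨γ, hγ, h⟩ := hA.posDef
  rw [pencil_eq h₀ h₁, Matrix.posDef_diagonal_iff] at h
  exact ⟨γ, hγ, fun i hi => h ⟨i, hi⟩⟩

section Constants

variable {α β : ℝ} {j k : ℕ}

theorem gammaPlus_eq (h₀ : q₀.A.IsDiag) (h₁ : q₁.A.IsDiag)
    (hI : (diagData q₀ q₁).IsInterval α β j k) : gammaPlus q₀ q₁ = β := by
  refine IsGreatest.csSup_eq ⟨⟨(hI.pos.trans hI.lt).le, ?_⟩, ?_⟩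
  · rw [pencil_eq h₀ h₁, Matrix.posSemidef_diagonal_iff]
    exact fun i => hI.diag_right i i.2
  · rintro γ ⟨_, h⟩
    rw [pencil_eq h₀ h₁, Matrix.posSemidef_diagonal_iff] at h
    have hk : 0 ≤ (diagData q₀ q₁).diag γ k := h ⟨k, hI.right_lt⟩
    have e := hI.right_eq
    have neg := hI.right_neg
    simp only [DiagData.diag] at hk e
    by_contra! hlt
    nlinarith

/-- Outside `[α, β]` the entry `j` or `k` is negative. Inside, entries are affine and nonnegative at
both ends, so none exceeds twice its midpoint value. -/
theorem lambdaMin_pencil_le (h₀ : q₀.A.IsDiag) (h₁ : q₁.A.IsDiag)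
    (hI : (diagData q₀ q₁).IsInterval α β j k) (γ : ℝ) {i : ℕ} (hi : i < n) :
    lambdaMin (pencil q₀ q₁ γ) ≤ 2 * (diagData q₀ q₁).diag ((α + β) / 2) i := by
  have hlt := hI.lt
  have hmid := hI.diag_pos ((α + β) / 2) (by linarith) (by linarith) i hi
  rw [pencil_eq h₀ h₁]
  rcases lt_or_ge γ α with h | h
  · refine (lambdaMin_diagonal_le _ ⟨j, hI.left_lt⟩).trans ?_
    have e := hI.left_eq
    have pos := hI.left_pos
    simp only [DiagData.diag] at e hmid ⊢
    nlinarith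
  rcases lt_or_ge β γ with h' | h'
  · refine (lambdaMin_diagonal_le _ ⟨k, hI.right_lt⟩).trans ?_
    have e := hI.right_eq
    have neg := hI.right_neg
    simp only [DiagData.diag] at e hmid ⊢
    nlinarith
  · exact (lambdaMin_diagonal_le _ ⟨i, hi⟩).trans (hI.diag_le h h' hi)

theorem xiStar_pos (h₀ : q₀.A.IsDiag) (h₁ : q₁.A.IsDiag)
    (hI : (diagData q₀ q₁).IsInterval α β j k) : 0 < xiStar q₀ q₁ := by
  have hlt := hI.lt
  have hpos := hI.pos
  have hmid : 0 < lambdaMin (pencil q₀ q₁ ((α + β) / 2)) := by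
    rw [pencil_eq h₀ h₁]
    exact lambdaMin_diagonal_pos (Nat.zero_lt_of_lt hI.left_lt)
      fun i => hI.diag_pos ((α + β) / 2) (by linarith) (by linarith) i i.2
  refine lt_min one_pos (hmid.trans_le ?_)
  refine le_csSup ⟨2 * (diagData q₀ q₁).diag ((α + β) / 2) j, ?_⟩
    ⟨_, Set.mem_Ici.mpr (by linarith), rfl⟩
  rintro _ ⟨γ, _, rfl⟩
  exact lambdaMin_pencil_le h₀ h₁ hI γ hI.left_lt

theorem xiStar_le (h₀ : q₀.A.IsDiag) (h₁ : q₁.A.IsDiag)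
    (hI : (diagData q₀ q₁).IsInterval α β j k) {i : ℕ} (hi : i < n) :
    xiStar q₀ q₁ ≤ 2 * (diagData q₀ q₁).diag ((α + β) / 2) i := by
  refine (min_le_right _ _).trans (csSup_le (Set.nonempty_Ici.image _) ?_)
  rintro _ ⟨γ, _, rfl⟩
  exact lambdaMin_pencil_le h₀ h₁ hI γ hi

/-- The minimizer has squared norm at most `64(ζ/ξ)²`, so `|q₁|` there is at most `1 + 2·64(ζ/ξ)² +
1`. -/
theorem DiagData.abs_slope_le {D : DiagData} {s ζ ξ : ℝ} (hs : 0 ≤ s) (hsζ : s ≤ ζ)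
    (hζ : 1 ≤ ζ) (hξ : 0 < ξ) (hξ1 : ξ ≤ 1) (hc : |D.c₁| ≤ 1)
    (hb₀ : ∑ i ∈ Finset.range D.n, D.b₀ i ^ 2 ≤ 1)
    (hb₁ : ∑ i ∈ Finset.range D.n, D.b₁ i ^ 2 ≤ 1) (ha : ∀ i < D.n, |D.a₁ i| ≤ 1)
    (hd : ∀ i < D.n, ξ / 4 ≤ D.diag s i) : |D.slope s| ≤ 130 * (ζ / ξ) ^ 2 := by
  have hx : ∑ i ∈ Finset.range D.n, D.argmin s i ^ 2 ≤ 64 * (ζ / ξ) ^ 2 := by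
    have hle : ∀ i ∈ Finset.range D.n, D.argmin s i ^ 2 ≤
        32 * (ζ / ξ) ^ 2 * D.b₀ i ^ 2 + 32 * (ζ / ξ) ^ 2 * D.b₁ i ^ 2 := by
      intro i hi
      have hdi := hd i (Finset.mem_range.mp hi)
      have hpos : 0 < D.diag s i := by linarith
      have hnum : (D.b₀ i + s * D.b₁ i) ^ 2 ≤ 2 * ζ ^ 2 * (D.b₀ i ^ 2 + D.b₁ i ^ 2) := by
        have e1 : s ^ 2 * D.b₁ i ^ 2 ≤ ζ ^ 2 * D.b₁ i ^ 2 := by gcongr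
        have e2 : 1 * D.b₀ i ^ 2 ≤ ζ ^ 2 * D.b₀ i ^ 2 := by
          gcongr; exact one_le_pow₀ hζ
        nlinarith [sq_nonneg (D.b₀ i - s * D.b₁ i)]
      rw [argmin, div_pow, neg_sq]
      calc (D.b₀ i + s * D.b₁ i) ^ 2 / D.diag s i ^ 2
          ≤ 2 * ζ ^ 2 * (D.b₀ i ^ 2 + D.b₁ i ^ 2) / (ξ / 4) ^ 2 := by gcongr
        _ = _ := by field_simp; ring
    have := Finset.sum_le_sum hle
    rw [Finset.sum_add_distrib, ← Finset.mul_sum, ← Finset.mul_sum] at this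
    have h0 : 0 ≤ 32 * (ζ / ξ) ^ 2 := by positivity
    nlinarith [mul_le_mul_of_nonneg_left hb₀ h0, mul_le_mul_of_nonneg_left hb₁ h0]
  have hterm : ∀ i ∈ Finset.range D.n,
      |(D.a₁ i * D.argmin s i + 2 * D.b₁ i) * D.argmin s i| ≤
        2 * D.argmin s i ^ 2 + D.b₁ i ^ 2 := by
    intro i hi
    obtain ⟨h1, h2⟩ := abs_le.mp (ha i (Finset.mem_range.mp hi))
    generalize D.argmin s i = x
    generalize D.b₁ i = b
    generalize D.a₁ i = a at *
    rw [abs_le]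
    constructor
    · nlinarith [sq_nonneg (x + b), mul_nonneg (by linarith : 0 ≤ a + 1) (sq_nonneg x)]
    · nlinarith [sq_nonneg (x - b), mul_nonneg (by linarith : 0 ≤ 1 - a) (sq_nonneg x)]
  have hsum := (Finset.abs_sum_le_sum_abs _ _).trans (Finset.sum_le_sum hterm)
  rw [Finset.sum_add_distrib, ← Finset.mul_sum] at hsum
  have hκ : 1 ≤ (ζ / ξ) ^ 2 := one_le_pow₀ ((one_le_div hξ).mpr (hξ1.trans hζ))
  have := abs_add_le D.c₁ (∑ i ∈ Finset.range D.n,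
    (D.a₁ i * D.argmin s i + 2 * D.b₁ i) * D.argmin s i)
  rw [slope, q₁]
  linarith

theorem abs_slope_le_kappaStar (hA : Assumption q₀ q₁) (h₀ : q₀.A.IsDiag) (h₁ : q₁.A.IsDiag)
    (hI : (diagData q₀ q₁).IsInterval α β j k) {s : ℝ} (hs : (β - α) / 4 ≤ s - α)
    (hs' : (β - α) / 4 ≤ β - s) :
    |(diagData q₀ q₁).slope s| ≤ 130 * kappaStar q₀ q₁ ^ 2 := by
  have hlt := hI.lt
  have hpos := hI.pos
  refine DiagData.abs_slope_le (by linarith) (s := s) ?_ (le_max_left _ _)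
    (xiStar_pos h₀ h₁ hI) (min_le_left _ _) hA.abs_c₁ (sum_sq_le hA.norm_b₀)
    (sum_sq_le hA.norm_b₁) ?_ ?_
  · rw [zetaStar, gammaPlus_eq h₀ h₁ hI]
    exact le_trans (by linarith) (le_max_right _ _)
  · intro i hi
    have := (abs_diag_le q₁.A ⟨i, hi⟩).trans hA.norm_A₁
    change |ofVec q₁.A.diag (⟨i, hi⟩ : Fin n)| ≤ 1
    rwa [ofVec_fin]
  · intro i hi
    -- On the middle half an entry is at least half its midpoint value, which is itself at least
    -- `ξ*/2`; this gives `ξ*/4`.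
    have e1 := hI.mul_diag_mid_le hs hs' hi
    have e2 := xiStar_le h₀ h₁ hI hi
    have hw := sub_pos.mpr hlt
    refine le_of_mul_le_mul_left ?_ hw
    nlinarith

/-- The bisection ends after `O(max {1, κ* √ζ* / √ε})` steps. -/
theorem Bracket.lt_bound {ε l u : ℝ} {m : ℕ} (hA : Assumption q₀ q₁) (h₀ : q₀.A.IsDiag)
    (h₁ : q₁.A.IsDiag) (hI : (diagData q₀ q₁).IsInterval α β j k) (hε : 0 < ε)
    (hB : Bracket (diagData q₀ q₁).slope α β ε m l u) :
    m < ⌈32 * max 1 (kappaStar q₀ q₁ * √(zetaStar q₀ q₁) / √ε)⌉₊ := by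
  have hlt := hI.lt
  have hpos := hI.pos
  have hH : ∀ s, (β - α) / 4 ≤ s - α → (β - α) / 4 ≤ β - s →
      |(diagData q₀ q₁).slope s| ≤ 130 * kappaStar q₀ q₁ ^ 2 :=
    fun s h h' => abs_slope_le_kappaStar hA h₀ h₁ hI h h'
  have key := hB.two_pow_lt hε (hH _ (by linarith) (by linarith))
    (fun s t a b c => hI.slope_antitone a b c)
    (fun s t d a b c e => hI.slope_sub_le hH a b c e) hlt
  set Y := max 1 (kappaStar q₀ q₁ * √(zetaStar q₀ q₁) / √ε) with hY
  have hY1 : 1 ≤ Y := le_max_left _ _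
  have hβζ : β ≤ zetaStar q₀ q₁ := by
    rw [zetaStar, gammaPlus_eq h₀ h₁ hI]; exact le_max_right _ _
  have hζ : 1 ≤ zetaStar q₀ q₁ := le_max_left _ _
  have hκ : 0 < kappaStar q₀ q₁ := div_pos (by linarith) (xiStar_pos h₀ h₁ hI)
  have hle : 130 * kappaStar q₀ q₁ ^ 2 * (β - α) / ε ≤ 130 * Y ^ 2 := by
    have h1 : kappaStar q₀ q₁ ^ 2 * zetaStar q₀ q₁ / ε =
        (kappaStar q₀ q₁ * √(zetaStar q₀ q₁) / √ε) ^ 2 := by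
      rw [div_pow, mul_pow, Real.sq_sqrt (by linarith), Real.sq_sqrt hε.le]
    calc 130 * kappaStar q₀ q₁ ^ 2 * (β - α) / ε
        ≤ 130 * kappaStar q₀ q₁ ^ 2 * zetaStar q₀ q₁ / ε := by gcongr; linarith
      _ = 130 * (kappaStar q₀ q₁ ^ 2 * zetaStar q₀ q₁ / ε) := by ring
      _ ≤ 130 * Y ^ 2 := by
        rw [h1]; gcongr; exact le_max_right _ _
  have hmax : max 1 (130 * kappaStar q₀ q₁ ^ 2 * (β - α) / ε) ≤ 130 * Y ^ 2 :=
    max_le (by nlinarith) hle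
  -- `24 · 130³ = 52728000 < 2^26`.
  have h26 : (2 : ℝ) ^ m < 2 ^ 26 * Y ^ 6 := by
    calc (2 : ℝ) ^ m < 24 * (max 1 (130 * kappaStar q₀ q₁ ^ 2 * (β - α) / ε)) ^ 3 := key
      _ ≤ 24 * (130 * Y ^ 2) ^ 3 := by gcongr
      _ = 24 * 130 ^ 3 * Y ^ 6 := by ring
      _ ≤ _ := by gcongr; norm_num
  -- Bernoulli's inequality; it turns the logarithmic bound into `m < 26 + 6Y ≤ 32Y`.
  have hYpow : Y ≤ (2 : ℝ) ^ Y := by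
    have := one_add_mul_self_le_rpow_one_add (by norm_num : (-1 : ℝ) ≤ 1) hY1
    norm_num at this
    linarith
  have hlt' : (2 : ℝ) ^ (m : ℝ) < (2 : ℝ) ^ (26 + 6 * Y) := by
    rw [Real.rpow_natCast, Real.rpow_add two_pos, mul_comm 6 Y, Real.rpow_mul two_pos.le]
    norm_cast at h26 ⊢
    refine h26.trans_le ?_
    push_cast
    gcongr
  have := (Real.rpow_lt_rpow_left_iff one_lt_two).mp hlt'
  rw [Nat.lt_ceil]
  linarith

end Constants

end GTRS

namespace GTRS
open RealRAM

/-! ### The program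

Natural registers: `0` holds `n`, `1` is the loop counter, `2` and `3` hold the degenerate
directions `j`, `k` at the end points `α`, `β`, and `4` the direction of the final step. Real
registers: `1`, `2` hold `c₁`, `ε`; `3`, `4` hold `α`, `β`; `5`, `6` the bracket, `7` its
midpoint, `8` the slope there. Real array `4` holds the current point. -/

/-- Minimize `q₀ + m q₁` at the midpoint `m` of the bracket and evaluate `q₁`. -/
def evalCmd : Cmd :=
  .seq (.rset 7 (.div (.add (.reg 5) (.reg 6)) (.const 2)))
    (.seq (.rset 8 (.reg 1))
      (forLoop
        (.seq
          (.rput 4 (.reg 1)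
            (.div (.sub (.const 0) (.add (.get 2 (.reg 1)) (.mul (.reg 7) (.get 3 (.reg 1)))))
              (.add (.get 0 (.reg 1)) (.mul (.reg 7) (.get 1 (.reg 1))))))
          (.rset 8 (.add (.reg 8)
            (.mul (.add (.mul (.get 1 (.reg 1)) (.get 4 (.reg 1)))
              (.mul (.const 2) (.get 3 (.reg 1)))) (.get 4 (.reg 1))))))))

def setupCmd : Cmd :=
  .seq (maxRatio 1 0 2 3) (.seq (maxRatio 0 1 3 4)
    (.seq (.rset 4 (.div (.const 1) (.reg 4)))
      (.seq (.rset 5 (.reg 3)) (.rset 6 (.reg 4)))))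

/-- The negation of the termination test. -/
def continueTest : BExp :=
  .not (.and (.rle (.mul (.sub (.reg 4) (.reg 7)) (.reg 8)) (.reg 2))
    (.rle (.mul (.sub (.reg 7) (.reg 3)) (.sub (.const 0) (.reg 8))) (.reg 2)))

def halveCmd : Cmd :=
  .seq (.ite (.not (.rle (.reg 8) (.const 0))) (.rset 5 (.reg 7)) (.rset 6 (.reg 7))) evalCmd

/-- Move along an axis to the surface `q₁ = 0`. -/
def stepCmd : Cmd :=
  .seq (.ite (.rle (.const 0) (.reg 8)) (.nset 4 (.reg 3)) (.nset 4 (.reg 2)))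
    (.seq (.rset 9 (.add (.mul (.get 1 (.reg 4)) (.get 4 (.reg 4))) (.get 3 (.reg 4))))
      (.seq (.ite (.rle (.const 0) (.reg 9)) (.rset 10 (.const 1)) (.rset 10 (.const (-1))))
        (.rput 4 (.reg 4) (.add (.get 4 (.reg 4))
          (.div (.add (.sub (.const 0) (.reg 9)) (.mul (.reg 10)
            (.sqrt (.sub (.mul (.reg 9) (.reg 9)) (.mul (.get 1 (.reg 4)) (.reg 8))))))
            (.get 1 (.reg 4)))))))

def solveCmd : Cmd :=
  .seq setupCmd (.seq evalCmd (.seq (.loop continueTest halveCmd) stepCmd))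

/-- The registers and arrays that stay fixed during the bisection. -/
structure Loaded (D : DiagData) (ε α β : ℝ) (j k : ℕ) (s : State) : Prop where
  n0 : s.nreg 0 = D.n
  n2 : s.nreg 2 = j
  n3 : s.nreg 3 = k
  r1 : s.rreg 1 = D.c₁
  r2 : s.rreg 2 = ε
  r3 : s.rreg 3 = α
  r4 : s.rreg 4 = β
  a0 : s.rarr 0 = D.a₀
  a1 : s.rarr 1 = D.a₁
  a2 : s.rarr 2 = D.b₀
  a3 : s.rarr 3 = D.b₁

/-- The current bracket is `[l, u]`, and its midpoint has been evaluated. -/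
structure Evaluated (D : DiagData) (ε α β : ℝ) (j k : ℕ) (l u : ℝ) (s : State) : Prop
    extends Loaded D ε α β j k s where
  r5 : s.rreg 5 = l
  r6 : s.rreg 6 = u
  r7 : s.rreg 7 = (l + u) / 2
  r8 : s.rreg 8 = D.slope ((l + u) / 2)
  a4 : ∀ i < D.n, s.rarr 4 i = D.argmin ((l + u) / 2) i

/-! ### Correctness and running time of the program. -/

variable {D : DiagData} {ε α β l u : ℝ} {j k : ℕ}

theorem runs_evalCmd {s : State} (hs : Loaded D ε α β j k s) (h5 : s.rreg 5 = l)
    (h6 : s.rreg 6 = u) :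
    Runs evalCmd s (D.n * 45 + 20) (Evaluated D ε α β j k l u) := by
  refine Runs.mono (T := 6 + (2 + (D.n * (35 + 10) + 8)))
    (Runs.seq (Runs.rset (Runs.seq (Runs.rset (Runs.mono (Runs.forLoop (n := D.n) (T := 35)
      (fun i s => Loaded D ε α β j k s ∧ s.rreg 5 = l ∧ s.rreg 6 = u ∧
        s.rreg 7 = (l + u) / 2 ∧
        s.rreg 8 = D.c₁ + ∑ i ∈ Finset.range i, (D.a₁ i * D.argmin ((l + u) / 2) i
          + 2 * D.b₁ i) * D.argmin ((l + u) / 2) i ∧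
        ∀ i' < i, s.rarr 4 i' = D.argmin ((l + u) / 2) i') ?_ ?_ ?_ ?_) le_rfl ?_))))) 
      (by omega) (fun _ h => h)
  · exact fun _ _ h => h.1.n0
  · rintro i k' s ⟨h, h'⟩
    exact ⟨⟨by simpa [State.setN] using h.n0, by simpa [State.setN] using h.n2,
      by simpa [State.setN] using h.n3, h.r1, h.r2, h.r3, h.r4, h.a0, h.a1, h.a2, h.a3⟩, h'⟩
  · rintro i s hi hc ⟨h, h5, h6, h7, h8, h4⟩
    refine Runs.mono (Runs.seq (Runs.rput (Runs.rset ?_)))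
      (by simp [RExp.cost, NExp.cost]) (fun _ h => h)
    have hx : -(D.b₀ i + (l + u) / 2 * D.b₁ i) / (D.a₀ i + (l + u) / 2 * D.a₁ i) =
      D.argmin ((l + u) / 2) i := rfl
    simp only [RExp.val, NExp.val, State.setR, State.putR, hc, h.a0, h.a1, h.a2, h.a3, h7, h8,
      Rat.cast_zero, zero_sub, hx]
    refine ⟨trivial, ⟨h.n0, h.n2, h.n3, ?_, ?_, ?_, ?_, ?_, ?_, ?_, ?_⟩, ?_, ?_, ?_, ?_, ?_⟩
    all_goals
      simp [Function.update_apply, h.r1, h.r2, h.r3, h.r4, h.a0, h.a1, h.a2, h.a3, h5, h6, h7]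
    · rw [Finset.sum_range_succ, add_assoc]
    · intro i' hi'
      split_ifs with h'
      · rw [h']
      · exact h4 i' (by omega)
  · simp only [RExp.val, State.setR]
    refine ⟨⟨hs.n0, hs.n2, hs.n3, ?_, ?_, ?_, ?_, hs.a0, hs.a1, hs.a2, hs.a3⟩, ?_, ?_, ?_, ?_, ?_⟩
    all_goals simp [hs.r1, hs.r2, hs.r3, hs.r4, h5, h6]
  · rintro s ⟨h, h5, h6, h7, h8, h4⟩
    exact ⟨h, h5, h6, h7, h8, h4⟩

theorem continueTest_holds {s : State} (hs : Evaluated D ε α β j k l u s) :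
    continueTest.holds s ↔
      ¬ ((β - (l + u) / 2) * D.slope ((l + u) / 2) ≤ ε ∧
        ((l + u) / 2 - α) * -D.slope ((l + u) / 2) ≤ ε) := by
  simp [continueTest, BExp.holds, RExp.val, hs.r2, hs.r3, hs.r4, hs.r7, hs.r8]

theorem runs_halveCmd {s : State} (hs : Evaluated D ε α β j k l u s) :
    Runs halveCmd s (D.n * 45 + 28) fun s' =>
      (0 < D.slope ((l + u) / 2) → Evaluated D ε α β j k ((l + u) / 2) u s') ∧
      (¬ 0 < D.slope ((l + u) / 2) → Evaluated D ε α β j k l ((l + u) / 2) s') := by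
  have hL : ∀ v, 4 < v → ∀ r, Loaded D ε α β j k (s.setR v r) := by
    intro v hv r
    have h : ∀ w, w ≤ 4 → (s.setR v r).rreg w = s.rreg w :=
      fun w hw => Function.update_of_ne (by omega) _ _
    exact ⟨hs.n0, hs.n2, hs.n3, (h 1 (by norm_num)).trans hs.r1, (h 2 (by norm_num)).trans hs.r2,
      (h 3 (by norm_num)).trans hs.r3, (h 4 (by norm_num)).trans hs.r4, hs.a0, hs.a1, hs.a2, hs.a3⟩
  refine Runs.mono (T := 8 + (D.n * 45 + 20)) (Runs.seq (Runs.mono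
    (Runs.ite (T := 2) ?_ ?_) (by simp [BExp.cost, RExp.cost]) (fun _ h => h))) (by omega)
    (fun _ h => h)
  · intro hb
    simp only [BExp.holds, RExp.val, hs.r8, Rat.cast_zero, not_le] at hb
    refine Runs.rset (e := .reg 7) ((runs_evalCmd (l := (l + u) / 2) (u := u)
      (hL 5 (by norm_num) _) ?_ ?_).mono le_rfl fun s' h => ⟨fun _ => h, fun h' => absurd hb h'⟩)
    all_goals simp [State.setR, RExp.val, hs.r6, hs.r7]
  · intro hb
    simp only [BExp.holds, RExp.val, hs.r8, Rat.cast_zero, not_le] at hb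
    refine Runs.rset (e := .reg 7) ((runs_evalCmd (l := l) (u := (l + u) / 2)
      (hL 6 (by norm_num) _) ?_ ?_).mono le_rfl fun s' h => ⟨fun h' => absurd h' hb, fun _ => h⟩)
    all_goals simp [State.setR, RExp.val, hs.r5, hs.r7]

theorem runs_stepCmd {s : State} (hI : D.IsInterval α β j k)
    (hs : Evaluated D ε α β j k l u s) :
    Runs stepCmd s 50 fun s' => ∀ i < D.n, s'.rarr 4 i =
      Function.update (D.argmin ((l + u) / 2))
        (if 0 ≤ D.slope ((l + u) / 2) then k else j)
        (D.argmin ((l + u) / 2) (if 0 ≤ D.slope ((l + u) / 2) then k else j) +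
          D.step ((l + u) / 2) (if 0 ≤ D.slope ((l + u) / 2) then k else j)) i := by
  have h1 : Runs (.ite (.rle (.const 0) (.reg 8)) (.nset 4 (.reg 3)) (.nset 4 (.reg 2))) s 6
      fun s' => s' = s.setN 4 (if 0 ≤ D.slope ((l + u) / 2) then k else j) := by
    refine (Runs.ite (T := 2) ?_ ?_).mono (by simp [BExp.cost, RExp.cost]) (fun _ h => h) <;>
    · intro hb
      simp only [BExp.holds, RExp.val, hs.r8, Rat.cast_zero] at hb
      refine Runs.nset ?_
      simp [hb, NExp.val, hs.n2, hs.n3]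
  have hlt : (if 0 ≤ D.slope ((l + u) / 2) then k else j) < D.n := by
    split_ifs
    exacts [hI.right_lt, hI.left_lt]
  generalize (if 0 ≤ D.slope ((l + u) / 2) then k else j) = i at *
  refine Runs.mono (T := 6 + (9 + (6 + 24))) (Runs.seq (h1.mono le_rfl ?_)) (by norm_num)
    (fun _ h => h)
  rintro _ rfl
  have hx := hs.a4 i hlt
  -- Register `9` receives half the derivative of `q₁` along the axis, and register `10` then its
  -- sign, with `+1` at zero as in `DiagData.step`.
  refine Runs.seq (Runs.mono (Runs.rset ?_) (T' := 9) (by simp [RExp.cost, NExp.cost])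
    (fun _ h => h))
  have h2 : ∀ s', Runs (.ite (.rle (.const 0) (.reg 9)) (.rset 10 (.const 1))
      (.rset 10 (.const (-1)))) s' 6
      fun s'' => s'' = s'.setR 10 (if 0 ≤ s'.rreg 9 then 1 else -1) := by
    intro s'
    refine (Runs.ite (T := 2) ?_ ?_).mono (by simp [BExp.cost, RExp.cost]) (fun _ h => h) <;>
    · intro hb
      simp only [BExp.holds, RExp.val, Rat.cast_zero] at hb
      refine Runs.rset ?_
      simp [hb, RExp.val]
  refine Runs.seq ((h2 _).mono le_rfl ?_)
  rintro _ rfl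
  refine Runs.mono (Runs.rput ?_) (by simp [RExp.cost, NExp.cost]) (fun _ h => h)
  intro i' hi'
  simp only [State.putR, State.setR, State.setN, RExp.val, NExp.val, Function.update_self,
    hs.a1, hs.a3, hx, Rat.cast_zero, zero_sub, Function.update_apply]
  simp only [DiagData.step, hs.r8, hs.a4 i' hi']
  simp [pow_two]

theorem runs_setupCmd {s : State} (hn : s.nreg 0 = D.n) (h1 : s.rreg 1 = D.c₁)
    (h2 : s.rreg 2 = ε) (h3 : s.rreg 3 = 0) (h4 : s.rreg 4 = 0) (ha0 : s.rarr 0 = D.a₀)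
    (ha1 : s.rarr 1 = D.a₁) (ha2 : s.rarr 2 = D.b₀) (ha3 : s.rarr 3 = D.b₁)
    {γ : ℝ} (hγ : 0 ≤ γ) (hpos : ∀ i < D.n, 0 < D.diag γ i) (h₀ : ∃ i < D.n, D.a₀ i < 0)
    (h₁ : ∃ i < D.n, D.a₁ i < 0) :
    Runs setupCmd s (D.n * 74 + 24) fun s' => ∃ α β j k, D.IsInterval α β j k ∧
      Loaded D ε α β j k s' ∧ s'.rreg 5 = α ∧ s'.rreg 6 = β := by
  refine Runs.mono (T := D.n * 37 + 8 + (D.n * 37 + 8 + (4 + (2 + 2)))) (Runs.seq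
    ((runs_maxRatio (by norm_num) (by norm_num) hn h3).mono le_rfl ?_)) (by omega)
    (fun _ h => h)
  rintro s₁ ⟨e1, e2, e3, e4, -, e6⟩
  rw [ha0, ha1] at e4 e6
  refine Runs.seq ((runs_maxRatio (n := D.n) (by norm_num) (by norm_num)
    (by rw [e2 _ (by norm_num) (by norm_num), hn]) (by rw [e3 _ (by norm_num), h4])).mono
      le_rfl ?_)
  rintro s₂ ⟨f1, f2, f3, f4, -, f6⟩
  rw [e1, ha0, ha1] at f4 f6
  rw [← f3 3 (by norm_num)] at e4 e6
  rw [← f2 2 (by norm_num) (by norm_num)] at e6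
  refine Runs.seq (Runs.rset (Runs.seq (Runs.rset (Runs.rset ?_))))
  refine ⟨_, _, _, _, DiagData.isInterval_of_ratios hγ hpos h₀ h₁ e4 e6 f4 f6, ?_, ?_, ?_⟩
  · constructor
    all_goals simp [State.setR, RExp.val, f1, e1, f2, e2, f3, e3, hn, h1, h2, ha0, ha1, ha2, ha3]
  all_goals simp [State.setR, RExp.val]

/-- The bound `hK` ranges over all intervals and brackets because `α`, `β`, `j`, `k` are only
produced during the run. -/
theorem runs_solveCmd {s : State} {K : ℕ} (hε : 0 < ε) (hn : s.nreg 0 = D.n)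
    (h1 : s.rreg 1 = D.c₁) (h2 : s.rreg 2 = ε) (h3 : s.rreg 3 = 0) (h4 : s.rreg 4 = 0)
    (ha0 : s.rarr 0 = D.a₀) (ha1 : s.rarr 1 = D.a₁) (ha2 : s.rarr 2 = D.b₀)
    (ha3 : s.rarr 3 = D.b₁) {γ : ℝ} (hγ : 0 ≤ γ) (hpos : ∀ i < D.n, 0 < D.diag γ i)
    (h₀ : ∃ i < D.n, D.a₀ i < 0) (h₁ : ∃ i < D.n, D.a₁ i < 0)
    (hK : ∀ α β j k l u m, D.IsInterval α β j k → Bracket D.slope α β ε m l u → m < K) :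
    Runs solveCmd s (K * (D.n * 45 + 50) + D.n * 119 + 200) fun s' => ∃ y : ℕ → ℝ,
      (∀ i < D.n, s'.rarr 4 i = y i) ∧ D.q₁ y = 0 ∧
      ∀ z, D.q₁ z ≤ 0 → D.q₀ y ≤ D.q₀ z + ε := by
  refine Runs.mono (T := D.n * 74 + 24 + (D.n * 45 + 20 +
      (K * (continueTest.cost + (D.n * 45 + 28) + 1) + (continueTest.cost + 1) + 50)))
    (Runs.seq ((runs_setupCmd hn h1 h2 h3 h4 ha0 ha1 ha2 ha3 hγ hpos h₀ h₁).mono le_rfl ?_))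
    ?_ (fun _ h => h)
  · rintro s₁ ⟨α, β, j, k, hI, hL, h5, h6⟩
    have hlt := hI.lt
    have hα := hI.pos
    refine Runs.seq ((runs_evalCmd hL h5 h6).mono le_rfl fun s₂ hE => ?_)
    refine Runs.seq ((Runs.loop (K := K) (T := D.n * 45 + 28) (fun m s => ∃ l u,
      Evaluated D ε α β j k l u s ∧ Bracket D.slope α β ε m l u) ?_ ?_ ?_).mono le_rfl ?_)
    · rintro m s ⟨l, u, _, hB⟩ _
      exact hK _ _ _ _ _ _ _ hI hB
    · rintro m s ⟨l, u, hE, hB⟩ hb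
      obtain ⟨g1, g2⟩ := hB.halve hε hlt rfl ((continueTest_holds hE).mp hb)
      refine (runs_halveCmd hE).mono le_rfl fun s' h => ?_
      by_cases hc : 0 < D.slope ((l + u) / 2)
      · exact ⟨_, _, h.1 hc, g1 hc⟩
      · exact ⟨_, _, h.2 hc, g2 hc⟩
    · exact ⟨α, β, hE, le_rfl, le_rfl, by simp, .inl rfl, .inl rfl, .inl rfl⟩
    · rintro s₃ ⟨⟨m, _, l, u, hE, hB⟩, hb⟩
      rw [continueTest_holds hE, not_not] at hb
      have hlu : 0 < u - l := by
        rw [hB.length]; exact div_pos (by linarith) (by positivity)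
      have b1 := hB.le_left
      have b2 := hB.right_le
      have hd := hI.diag_pos ((l + u) / 2) (by linarith) (by linarith)
      refine (runs_stepCmd hI hE).mono le_rfl fun s' h => ⟨_, h, ?_⟩
      -- Treats both exits at once: `(i, δ)` is `(k, β)` for nonnegative slope and `(j, α)` for
      -- negative slope, which makes `a₁ i` and the slope have opposite signs.
      have key : ∀ i δ, i < D.n → D.a₁ i ≠ 0 → D.diag δ i = 0 →
          D.a₁ i * D.slope ((l + u) / 2) ≤ 0 →
          (δ - (l + u) / 2) * D.slope ((l + u) / 2) ≤ ε →
          D.q₁ (Function.update (D.argmin ((l + u) / 2)) i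
            (D.argmin ((l + u) / 2) i + D.step ((l + u) / 2) i)) = 0 ∧
          ∀ z, D.q₁ z ≤ 0 → D.q₀ (Function.update (D.argmin ((l + u) / 2)) i
            (D.argmin ((l + u) / 2) i + D.step ((l + u) / 2) i)) ≤ D.q₀ z + ε :=
        fun i δ hi ha hδ hs he => ⟨D.q₁_update_step hi ha hs, fun z hz =>
          D.q₀_update_step_le (by linarith) hd hi ha hs
            (D.diag_mul_step_sq_le ha hδ hs (hd i hi).le he) hz⟩
      split_ifs with hc
      · exact key k β hI.right_lt hI.right_neg.ne hI.right_eq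
          (mul_nonpos_of_nonpos_of_nonneg hI.right_neg.le hc) hb.1
      · exact key j α hI.left_lt hI.left_pos.ne' hI.left_eq
          (mul_nonpos_of_nonneg_of_nonpos hI.left_pos.le (not_le.mp hc).le) (by linarith [hb.2])
  · have : continueTest.cost = 18 := rfl
    rw [this]
    have : K * (18 + (D.n * 45 + 28) + 1) ≤ K * (D.n * 45 + 50) :=
      Nat.mul_le_mul_left _ (by omega)
    omega

end GTRS

theorem mainTheorem8 :
    ∃ (P : RealRAM.Cmd) (C : ℝ), ∀ (n : ℕ) (q₀ q₁ : QuadFun n) (ε : ℝ),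
      GTRS.Assumption q₀ q₁ → q₀.A.IsDiag → q₁.A.IsDiag → 0 < ε →
      ∃ (t : ℕ) (s : RealRAM.State),
        RealRAM.Exec P (RealRAM.input q₀ q₁ ε) t s ∧
        q₀.eval (RealRAM.output n s) ≤ GTRS.opt q₀ q₁ + ε ∧
        q₁.eval (RealRAM.output n s) = 0 ∧
        (t : ℝ) ≤ C * (n * max 1
          (GTRS.kappaStar q₀ q₁ * Real.sqrt (GTRS.zetaStar q₀ q₁) / Real.sqrt ε)) := by
  refine ⟨GTRS.solveCmd, 3500, fun n q₀ q₁ ε hA h₀ h₁ hε => ?_⟩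
  obtain ⟨γ, hγ, hpos⟩ := GTRS.exists_diag_pos hA h₀ h₁
  have hneg := GTRS.exists_diag_neg h₀ hA.neg_eig₀
  obtain ⟨t, s, hexec, ht, y, hy, hy1, hyopt⟩ := GTRS.runs_solveCmd
    (D := GTRS.diagData q₀ q₁) (s := RealRAM.input q₀ q₁ ε) hε rfl rfl rfl rfl rfl rfl rfl rfl rfl
    hγ hpos hneg (GTRS.exists_diag_neg h₁ hA.neg_eig₁)
    (fun α β j k l u m hI hB => hB.lt_bound hA h₀ h₁ hI hε)
  have e0 := GTRS.eval_eq h₀ (RealRAM.output n s) y fun i => hy i i.2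
  have e1 : q₁.eval (RealRAM.output n s) = 0 :=
    (GTRS.eval_eq h₁ (RealRAM.output n s) y fun i => hy i i.2).trans hy1
  refine ⟨t, s, hexec, ?_, e1, ?_⟩
  · rw [← sub_le_iff_le_add]
    -- The output itself shows that the feasible set is nonempty.
    refine le_csInf ⟨_, _, e1.le, rfl⟩ ?_
    rintro _ ⟨x, hx, rfl⟩
    have hx0 := GTRS.eval_eq h₀ x (RealRAM.ofVec x) fun i => (GTRS.ofVec_fin _ i).symm
    have hx1 := GTRS.eval_eq h₁ x (RealRAM.ofVec x) fun i => (GTRS.ofVec_fin _ i).symm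
    have := hyopt (RealRAM.ofVec x) (hx1.symm.trans_le hx)
    simp only [GTRS.DiagData.q₀, GTRS.diagData] at this
    linarith
  · set Y := max 1 (GTRS.kappaStar q₀ q₁ * √(GTRS.zetaStar q₀ q₁) / √ε)
    have hY : 1 ≤ Y := le_max_left _ _
    -- A negative eigenvalue excludes `n = 0`, so additive constants are absorbed into multiples of
    -- `n`.
    have hn : (1 : ℝ) ≤ n := by
      obtain ⟨i, hi, -⟩ := hneg
      exact_mod_cast Nat.one_le_of_lt hi
    have hceil := (Nat.ceil_lt_add_one (by positivity : 0 ≤ 32 * Y)).le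
    have ht' : (t : ℝ) ≤ ⌈32 * Y⌉₊ * (n * 45 + 50) + n * 119 + 200 := by exact_mod_cast ht
    -- In total `33 · 95 + 119 + 200 = 3454 ≤ 3500`.
    have h1 : (⌈32 * Y⌉₊ : ℝ) * (n * 45 + 50) ≤ 33 * Y * (n * 95) := by
      gcongr <;> linarith
    nlinarith [mul_le_mul_of_nonneg_left hY (by positivity : (0 : ℝ) ≤ n)]
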